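/- **Model.** In the CONGEST model a communication network is an $n$-node undirected graph $G=(V,E)$ whose nodes all run the same deterministic code, with unrestricted local computation, in synchronous rounds. Each node has a unique $O(\log n)$-bit identifier and numbers its incident edges in an arbitrary way; in each round it may send one message of $O(\log n)$ bits to each neighbor, after which it updates its state from the messages it received. Each node $v$ has a weight $w(v)\in\mathbb R_{\ge 0}$ that can be represented by $O(\log n)$ bits (in an arbitrary fixed number format). Initially $v$ knows $n$, the arboricity $\alpha$ of $G$, its identifier, its weight and its degree. Eventually every node halts with an irrevocable decision whether it belongs to the output set $X\subseteq V$; the number of rounds is the time until all nodes have halted. The arboricity $\alpha$ is the smallest integer $\alpha>0$ such that $E$ can be partitioned into $\alpha$ pairwise disjoint sets $E_1,\dots,E_\alpha$ with each $(V,E_i)$ a forest. For $q\ge 1$, a set $X$ is a $q$-approximation for maximum weight independent set (MWIS) if $X$ is independent and $q\cdot\sum_{v\in X}w(v)\ge OPT(G)$, where $OPT(G)$ is the maximum weight of an independent set of $G$. **Theorem.** For any constant $\tau>0$ there is a deterministic CONGEST algorithm that computes an $O(\alpha)$-approximation for MWIS, more precisely an $(8^{k}\cdot\alpha)$-approximation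 with $k=\lceil 1/\tau\rceil$, in $O(\alpha^{\tau}\log n)$ rounds. Here the constants hidden in the $O(\log n)$ message size and in the number of rounds depend only on $\tau$ and on the constant $c$ in the $O(\log n)$ bounds on the identifiers and weights; they do not depend on the graph, the weights, the identifiers, or the number format. -/

import Mathlib

open scoped NNReal

/-! ### Graph notions -/

/-- The edges of `G` can be partitioned into `k` pairwise disjoint (possibly empty) sets, each of
which is the edge set of a forest on the vertex set of `G`. -/
def HasForestPartition {V : Type*} (G : SimpleGraph V) (k : ℕ) : Prop :=
  ∃ E : Fin k → Set (Sym2 V),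
    (⋃ i, E i) = G.edgeSet ∧
    (∀ i j, i ≠ j → Disjoint (E i) (E j)) ∧
    ∀ i, (SimpleGraph.fromEdgeSet (E i)).IsAcyclic

/-- The arboricity: the smallest *positive* integer `k` such that the edges can be partitioned into
`k` forests. In particular an edgeless graph has arboricity `1`. -/
noncomputable def arboricity {V : Type*} (G : SimpleGraph V) : ℕ :=
  sInf {k : ℕ | 0 < k ∧ HasForestPartition G k}

/-- The total weight `w(X)` of a set of nodes. -/
def setWeight {V : Type*} (w : V → ℝ≥0) (X : Finset V) : ℝ≥0 := ∑ v ∈ X, w v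

open Classical in
/-- `OPT(G)`: the maximum weight of an independent set of `G`. -/
noncomputable def optWeight {V : Type*} [Fintype V] (G : SimpleGraph V) (w : V → ℝ≥0) : ℝ≥0 :=
  (Finset.univ.filter fun Y : Finset V => G.IsIndepSet (Y : Set V)).sup (setWeight w)

/-- `X` is a `q`-approximation for maximum weight independent set: it is an independent set
with `q * w(X) ≥ OPT(G)`. -/
def IsMWISApprox {V : Type*} [Fintype V] (G : SimpleGraph V) (w : V → ℝ≥0) (q : ℝ≥0)
    (X : Finset V) : Prop :=
  G.IsIndepSet (X : Set V) ∧ optWeight G w ≤ q * setWeight w X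

/-! ### The CONGEST model -/

/-- A message is a finite bit string; the empty string stands for sending nothing. -/
abbrev Message : Type := List Bool

/-- A weighted communication network on the node set `V`. The incident edges of a node `v` are
numbered by ports `0, …, deg v - 1`, in an arbitrary order: port `i` of `v` leads to the `i`-th
entry of the list `nbrs v`. -/
structure Network (V : Type*) where
  graph : SimpleGraph V
  ident : V → ℕ
  ident_injective : Function.Injective ident
  weight : V → ℝ≥0
  nbrs : V → List V
  nbrs_nodup : ∀ v, (nbrs v).Nodup
  mem_nbrs : ∀ v u, u ∈ nbrs v ↔ graph.Adj v u

/-- `⌊log₂ n⌋ + 1`, the length of the binary expansion of `n ≥ 1`; `O(log n)` bits means at most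
`c * logBits n` bits for a constant `c`. -/
def logBits (n : ℕ) : ℕ := Nat.log 2 n + 1

/-- All identifiers have at most `c * logBits n` bits, and every weight is represented by a bit
string of at most `c * logBits n` bits in the number format `dec`, where `n` is the number of
nodes. -/
def Network.HasLogSizeInput {V : Type*} [Fintype V] (N : Network V) (c : ℕ)
    (dec : List Bool → ℝ≥0) : Prop :=
  (∀ v, Nat.size (N.ident v) ≤ c * logBits (Fintype.card V)) ∧
  ∀ v, ∃ s : List Bool, s.length ≤ c * logBits (Fintype.card V) ∧ dec s = N.weight v

/-- A deterministic synchronous message-passing algorithm for computing a subset of the nodes.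
All nodes run the same code and local computation is unrestricted.
* `init n a i x d` is the initial state of a node with identifier `i`, weight `x` and degree `d`
  in a network with `n` nodes and arboricity `a`;
* `send s p` is the message sent through port `p` by a node in state `s`;
* `recv s m` is the new state of a node in state `s` that received the messages `m`, listed in the
  order of its ports;
* `output s` is `none` as long as the node is running; when it is `some b`, the node has halted,
  with the decision to belong (`b = true`) or not to belong (`b = false`) to the computed set. -/
structure DistAlgorithm where
  State : Type
  init : (n a i : ℕ) → (x : ℝ≥0) → (d : ℕ) → State
  send : State → ℕ → Message
  recv : State → List Message → State
  output : State → Option Bool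

namespace DistAlgorithm

variable (A : DistAlgorithm)

/-- The message that actually leaves through port `p`: a halted node sends nothing. -/
def emit (s : A.State) (p : ℕ) : Message :=
  if (A.output s).isSome then [] else A.send s p

/-- The state update at the end of a round: a halted node keeps its state. -/
def update (s : A.State) (m : List Message) : A.State :=
  if (A.output s).isSome then s else A.recv s m

/-- The message sent by `u` to its neighbor `v` when the current states are `σ`. -/
def msg {V : Type*} [DecidableEq V] (N : Network V) (σ : V → A.State) (u v : V) : Message :=
  A.emit (σ u) ((N.nbrs u).idxOf v)

/-- The states of all nodes after `r` synchronous rounds. -/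
noncomputable def run {V : Type*} [Fintype V] [DecidableEq V] (N : Network V) :
    ℕ → V → A.State
  | 0 => fun v =>
      A.init (Fintype.card V) (arboricity N.graph) (N.ident v) (N.weight v) (N.nbrs v).length
  | r + 1 => fun v =>
      A.update (run N r v) ((N.nbrs v).map fun u => A.msg N (run N r) u v)

/-- Every message sent along an edge in any round has at most `b` bits. -/
def MessagesBounded {V : Type*} [Fintype V] [DecidableEq V] (N : Network V) (b : ℕ) : Prop :=
  ∀ (r : ℕ) (u v : V), N.graph.Adj u v → (A.msg N (A.run N r) u v).length ≤ b

/-- All nodes have halted after `r` rounds. -/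
def HaltsBy {V : Type*} [Fintype V] [DecidableEq V] (N : Network V) (r : ℕ) : Prop :=
  ∀ v, (A.output (A.run N r v)).isSome

/-- The set of nodes that have halted within `r` rounds with the decision to join. -/
noncomputable def outputSet {V : Type*} [Fintype V] [DecidableEq V] (N : Network V) (r : ℕ) :
    Finset V :=
  Finset.univ.filter fun v => A.output (A.run N r v) = some true

end DistAlgorithm

/-! ### Synchronous processes -/

/-! The algorithm runs `2k` stages on a shrinking set `U` of nodes, controlled by a sparsity `D`:
every `S ⊆ U` spans at most `D * |S|` edges. Initially `D = α` is admissible (`sparse_arboricity`),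
and sparsity `0` means independence. With `m` about `α^(1/(2k))`, each stage divides `D` by at least
`m`; since `m^(2k) > α`, the last set is independent.

A stage first arranges `U` in slots. Peeling (`peel_spec`) yields `O(log n)` layers in which a node
has at most `d = ⌊9D/4⌋` neighbors in its own or later layers. A defective coloring
(`layerColor_spec`) with `O(m²)` colors leaves every node at most `d / (2048 m)` neighbors of its
own layer and color. The pairs (layer, color) are the slots, `O(m² log n)` in number.

Two sweeps over the slots (`sweep_spec`) then carry out a local ratio argument with a tolerance `T`
of about `d / (64 m)`. Going forward, a node pushes the part of its weight not covered by `1 / (T +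
1)` times the pushes of its earlier neighbors. Going backward, a node with a nonzero push joins if
at most `T` later neighbors have joined. The joined set has sparsity at most `T` plus the defect,
and `local_ratio` bounds the loss of weight by a factor of about `1 + d / (T + 1)`.

This loss times the new sparsity is at most `5/2 * D`, so the losses telescope (`stagesLoss_le`) to
`(5/2)^(2k) * (32/25) * α ≤ 8^k * α`. A stage takes `O(m² log n)` rounds, and `m² ≤ 4 α^τ`. -/

/-- A local process that broadcasts natural numbers: it either stops with a result, or broadcasts a
number to all neighbors and continues with the numbers received, listed by ports. -/
inductive Proc (α : Type) : Type
  | pure (a : α) : Proc α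
  | round (m : ℕ) (k : List ℕ → Proc α) : Proc α

namespace Proc

variable {α β S : Type}

/-- Sequential composition. -/
def bind : Proc α → (α → Proc β) → Proc β
  | pure a, f => f a
  | round m k, f => round m fun l => (k l).bind f

/-- `N` rounds; in round `i` the state `s` is broadcast as `m i s` and updated by `f i s`. -/
def loop (m : ℕ → S → ℕ) (f : ℕ → S → List ℕ → S) (s : S) : ℕ → Proc S
  | 0 => pure s
  | N + 1 => (loop m f s N).bind fun x => round (m N x) fun l => pure (f N x l)

/-- When all nodes run the processes `P` synchronously, they stop after exactly `t` rounds with the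
results `out`, and all broadcast numbers have at most `b` bits. -/
inductive Runs {V : Type} (nbrs : V → List V) (b : ℕ) : ℕ → (V → Proc α) → (V → α) → Prop
  | pure (a : V → α) : Runs nbrs b 0 (fun v => .pure (a v)) a
  | round (t : ℕ) (m : V → ℕ) (k : V → List ℕ → Proc α) (a : V → α) (hm : ∀ v, m v < 2 ^ b)
      (h : Runs nbrs b t (fun v => k v ((nbrs v).map m)) a) :
      Runs nbrs b (t + 1) (fun v => .round (m v) (k v)) a

variable {V : Type} {nbrs : V → List V} {b t t' : ℕ}

/-- All nodes stop in the same round, so the second phase starts synchronously without any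
coordination. -/
theorem Runs.bind {P : V → Proc α} {Q : V → α → Proc β} {x : V → α} {y : V → β}
    (hP : Runs nbrs b t P x) (hQ : Runs nbrs b t' (fun v => Q v (x v)) y) :
    Runs nbrs b (t + t') (fun v => (P v).bind (Q v)) y := by
  induction hP with
  | pure a => simpa [Proc.bind] using hQ
  | round t m k a hm h ih =>
    have := Runs.round (t + t') m (fun v l => (k v l).bind (Q v)) y hm (ih hQ)
    rw [show t + 1 + t' = t + t' + 1 by ring]
    exact this

/-- The global states in a synchronous execution of `Proc.loop`. -/
def globalState (nbrs : V → List V) (m : V → ℕ → S → ℕ) (f : V → ℕ → S → List ℕ → S) (s : V → S) :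
    ℕ → V → S
  | 0 => s
  | i + 1 => fun v => f v i (globalState nbrs m f s i v)
      ((nbrs v).map fun u => m u i (globalState nbrs m f s i u))

theorem Runs.loop (m : V → ℕ → S → ℕ) (f : V → ℕ → S → List ℕ → S) (s : V → S) (N : ℕ)
    (hm : ∀ i < N, ∀ v, m v i (globalState nbrs m f s i v) < 2 ^ b) :
    Runs nbrs b N (fun v => Proc.loop (m v) (f v) (s v) N) (globalState nbrs m f s N) := by
  induction N with
  | zero => exact Runs.pure s
  | succ N ih =>
    refine (ih fun i hi => hm i (by omega)).bind (t' := 1)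
      (Q := fun v x => Proc.round (m v N x) fun l => Proc.pure (f v N x l)) ?_
    exact Runs.round 0 _ (fun v l => Proc.pure (f v N (globalState nbrs m f s N v) l)) _
      (hm N (by omega)) (Runs.pure _)

/-! ### Execution in the CONGEST model -/

/-- A left inverse of the binary expansion. -/
def ofBits (l : List Bool) : ℕ := l.foldr Nat.bit 0

theorem ofBits_bits (m : ℕ) : ofBits m.bits = m := by
  induction m using Nat.binaryRec' with
  | zero => simp [ofBits]
  | bit b n h ih =>
    rw [Nat.bits_append_bit _ _ h]
    simp only [ofBits, List.foldr_cons] at ih ⊢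
    rw [ih]

/-- The distributed algorithm in which every node runs a given process. -/
def toAlgorithm (P : (n a i : ℕ) → ℝ≥0 → ℕ → Proc Bool) : DistAlgorithm where
  State := Proc Bool
  init := P
  send s _ := match s with
    | pure _ => []
    | round m _ => m.bits
  recv s l := match s with
    | pure a => pure a
    | round _ k => k (l.map ofBits)
  output s := match s with
    | pure a => some a
    | round _ _ => none

variable [Fintype V] [DecidableEq V]

/-- The starting round `r₀` is arbitrary so that the induction can peel off one round at a time. -/
theorem run_of_runs_aux (P : (n a i : ℕ) → ℝ≥0 → ℕ → Proc Bool) (N : Network V)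
    {Q : V → Proc Bool} {out : V → Bool} (h : Runs N.nbrs b t Q out) :
    ∀ r₀, (toAlgorithm P).run N r₀ = Q →
      (∀ r ≥ r₀, ∀ u v, ((toAlgorithm P).msg N ((toAlgorithm P).run N r) u v).length ≤ b) ∧
      (toAlgorithm P).run N (r₀ + t) = fun v => .pure (out v) := by
  induction h with
  | pure a =>
    intro r₀ h₀
    refine ⟨fun r hr => ?_, h₀⟩
    have : (toAlgorithm P).run N r = fun v => .pure (a v) := by
      induction r, hr using Nat.le_induction with
      | base => exact h₀
      | succ r _ ih =>
        funext v
        simp only [DistAlgorithm.run, ih]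
        rfl
    intro u v
    rw [this]
    simp [DistAlgorithm.msg, DistAlgorithm.emit, toAlgorithm]
  | round t m k a hm h ih =>
    intro r₀ h₀
    have h₁ : (toAlgorithm P).run N (r₀ + 1) = fun v => k v ((N.nbrs v).map m) := by
      funext v
      simp only [DistAlgorithm.run, h₀]
      simp [DistAlgorithm.update, DistAlgorithm.msg, DistAlgorithm.emit, toAlgorithm,
        Function.comp_def, ofBits_bits]
    obtain ⟨h₂, h₃⟩ := ih (r₀ + 1) h₁
    refine ⟨fun r hr u v => ?_, by rw [← h₃]; congr 1; omega⟩
    rcases Nat.eq_or_lt_of_le hr with rfl | hr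
    · rw [h₀]
      simpa [DistAlgorithm.msg, DistAlgorithm.emit, toAlgorithm, Nat.size_eq_bits_len,
        Nat.size_le] using hm u
    · exact h₂ r hr u v

theorem toAlgorithm_spec (P : (n a i : ℕ) → ℝ≥0 → ℕ → Proc Bool) (N : Network V) {out : V → Bool}
    (h : Runs N.nbrs b t (fun v => P (Fintype.card V) (arboricity N.graph) (N.ident v) (N.weight v)
      (N.nbrs v).length) out) :
    (toAlgorithm P).MessagesBounded N b ∧ (toAlgorithm P).HaltsBy N t ∧
      (toAlgorithm P).outputSet N t = Finset.univ.filter fun v => out v = true := by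
  obtain ⟨h₁, h₂⟩ := run_of_runs_aux P N h 0 rfl
  rw [zero_add] at h₂
  refine ⟨fun r u v _ => h₁ r (Nat.zero_le r) u v, fun v => ?_, ?_⟩
  · rw [h₂]; rfl
  · simp only [DistAlgorithm.outputSet, h₂]
    simp [toAlgorithm]

end Proc

/-! ### Arboricity and sparsity -/

theorem isAcyclic_fromEdgeSet_singleton {V : Type*} (e : Sym2 V) :
    (SimpleGraph.fromEdgeSet {e}).IsAcyclic := by
  classical
  intro v p hp
  have h₁ : p.edges.toFinset ⊆ {e} := by
    intro x hx
    have := p.edges_subset_edgeSet (List.mem_toFinset.1 hx)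
    rw [SimpleGraph.edgeSet_fromEdgeSet] at this
    simpa using this.1
  have h₂ := Finset.card_le_card h₁
  rw [List.toFinset_card_of_nodup hp.isTrail.edges_nodup, SimpleGraph.Walk.length_edges,
    Finset.card_singleton] at h₂
  have := hp.three_le_length
  omega

/-- Each edge is a forest by itself. This makes the infimum defining the arboricity an attained
minimum. -/
theorem hasForestPartition_card_edgeSet {V : Type*} [Finite V] (G : SimpleGraph V) :
    HasForestPartition G (Nat.card G.edgeSet) := by
  let f := Finite.equivFin G.edgeSet
  refine ⟨fun i => {(f.symm i : Sym2 V)}, ?_, fun i j hij => ?_, fun i =>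
    isAcyclic_fromEdgeSet_singleton _⟩
  · ext e
    simp only [Set.mem_iUnion, Set.mem_singleton_iff]
    exact ⟨fun ⟨i, hi⟩ => hi ▸ (f.symm i).2, fun h => ⟨f ⟨e, h⟩, by rw [f.symm_apply_apply]⟩⟩
  · rw [Set.disjoint_singleton]
    exact fun h => hij (f.symm.injective (Subtype.ext h))

theorem HasForestPartition.succ {V : Type*} {G : SimpleGraph V} {k : ℕ}
    (h : HasForestPartition G k) : HasForestPartition G (k + 1) := by
  obtain ⟨E, h₁, h₂, h₃⟩ := h
  refine ⟨Fin.cons ∅ E, ?_, ?_, ?_⟩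
  · rw [← h₁]
    ext e
    simp
  · intro i j
    refine Fin.cases ?_ (fun i => ?_) i <;> refine Fin.cases ?_ (fun j => ?_) j <;> intro hij
    · exact absurd rfl hij
    · simp
    · simp
    · simpa using h₂ i j fun h => hij (h ▸ rfl)
  · intro i
    refine Fin.cases ?_ (fun i => ?_) i
    · simp
    · simpa using h₃ i

theorem arboricity_mem {V : Type*} [Finite V] (G : SimpleGraph V) :
    0 < arboricity G ∧ HasForestPartition G (arboricity G) :=
  Nat.sInf_mem (s := {k : ℕ | 0 < k ∧ HasForestPartition G k})
    ⟨_, Nat.succ_pos _, (hasForestPartition_card_edgeSet G).succ⟩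

/-- A crude polynomial bound suffices: it only serves to make quantities depending on `α` fit into
`O(log n)` bits. -/
theorem arboricity_le_sq {V : Type*} [Fintype V] (G : SimpleGraph V) :
    arboricity G ≤ Fintype.card V ^ 2 + 1 := by
  classical
  refine (Nat.sInf_le (s := {k : ℕ | 0 < k ∧ HasForestPartition G k})
    ⟨Nat.succ_pos _, (hasForestPartition_card_edgeSet G).succ⟩).trans ?_
  rw [Nat.card_eq_fintype_card, ← SimpleGraph.edgeFinset_card]
  have h₁ := SimpleGraph.card_edgeFinset_le_card_choose_two (G := G)
  have h₂ := Nat.choose_le_pow (Fintype.card V) 2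
  omega

/-- Every subset of `U` has at most `D` times as many inner edges as nodes. -/
def Sparse {V : Type*} [DecidableEq V] (Γ : V → Finset V) (U : Finset V) (D : ℕ) : Prop :=
  ∀ S ⊆ U, ∑ v ∈ S, (Γ v ∩ S).card ≤ 2 * D * S.card

/-- A forest on a nonempty node set extends to a spanning tree of the complete graph, which has one
edge less than nodes. -/
theorem SimpleGraph.IsAcyclic.sum_degree_le {W : Type*} [Fintype W] {H : SimpleGraph W}
    [DecidableRel H.Adj] (h : H.IsAcyclic) : ∑ v, H.degree v ≤ 2 * Fintype.card W := by
  classical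
  rw [SimpleGraph.sum_degrees_eq_twice_card_edges]
  rcases isEmpty_or_nonempty W with hW | hW
  · have := SimpleGraph.card_edgeFinset_le_card_choose_two (G := H)
    simp at this
    simp [this]
  · obtain ⟨T, hHT, -, hT⟩ := SimpleGraph.connected_top.exists_isTree_le_of_le_of_isAcyclic
      (le_top : H ≤ ⊤) h
    have h₁ := hT.card_edgeFinset
    have h₂ := Finset.card_le_card (SimpleGraph.edgeFinset_mono hHT)
    omega

/-- The easy half of the Nash-Williams theorem: each of the forests, restricted to `S`, has at most
`|S|` edges, and together they cover all edges inside `S`. -/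
theorem sparse_arboricity {V : Type*} [Fintype V] [DecidableEq V] {G : SimpleGraph V}
    {Γ : V → Finset V} (hΓ : ∀ v u, u ∈ Γ v ↔ G.Adj v u) :
    Sparse Γ Finset.univ (arboricity G) := by
  classical
  intro S _
  obtain ⟨-, E, h₁, -, h₃⟩ := arboricity_mem G
  generalize arboricity G = a at E h₁ h₃ ⊢
  let H : Fin a → SimpleGraph S := fun i => (SimpleGraph.fromEdgeSet (E i)).induce (S : Set V)
  have h₄ : ∀ i, ∑ v, (H i).degree v ≤ 2 * S.card := fun i => by
    have : (H i).IsAcyclic := (h₃ i).induce (S : Set V)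
    simpa using this.sum_degree_le
  have h₅ : ∀ v : S, (Γ v ∩ S).card ≤ ∑ i, (H i).degree v := by
    intro v
    have : Γ v ∩ S ⊆ Finset.univ.biUnion fun i =>
        ((H i).neighborFinset v).map (Function.Embedding.subtype _) := by
      intro u hu
      rw [Finset.mem_inter, hΓ] at hu
      have he : s((v : V), u) ∈ ⋃ i, E i := by rw [h₁]; exact hu.1
      obtain ⟨i, hi⟩ := Set.mem_iUnion.1 he
      simp only [Finset.mem_biUnion, Finset.mem_univ, true_and, Finset.mem_map]
      exact ⟨i, ⟨u, hu.2⟩, by simp [H, hi, hu.1.ne], rfl⟩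
    refine (Finset.card_le_card this).trans (Finset.card_biUnion_le.trans ?_)
    simp
  calc ∑ v ∈ S, (Γ v ∩ S).card = ∑ v : S, (Γ v ∩ S).card := (Finset.sum_coe_sort S _).symm
    _ ≤ ∑ v : S, ∑ i, (H i).degree v := Finset.sum_le_sum fun v _ => h₅ v
    _ = ∑ i, ∑ v : S, (H i).degree v := Finset.sum_comm
    _ ≤ ∑ _i : Fin a, 2 * S.card := Finset.sum_le_sum fun i _ => h₄ i
    _ = 2 * a * S.card := by simp; ring

section Sparse

variable {V : Type*} [DecidableEq V] {Γ : V → Finset V} {U : Finset V}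

/-- Charge each inner edge to its endpoint with the smaller slot; every node is charged at most `D`
times. -/
theorem sparse_of_slots (hΓ : ∀ v u, u ∈ Γ v ↔ v ∈ Γ u) (slot : V → ℕ) {D : ℕ}
    (h : ∀ v ∈ U, ((Γ v ∩ U).filter fun u => slot v ≤ slot u).card ≤ D) : Sparse Γ U D := by
  intro S hS
  have h₁ : ∀ v, (Γ v ∩ S).card ≤ ((Γ v ∩ S).filter fun u => slot v ≤ slot u).card +
      ((Γ v ∩ S).filter fun u => slot u ≤ slot v).card := by
    intro v
    rw [← Finset.card_filter_add_card_filter_not (s := Γ v ∩ S) (fun u => slot v ≤ slot u)]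
    gcongr with u _
    omega
  have h₂ : ∑ v ∈ S, ((Γ v ∩ S).filter fun u => slot u ≤ slot v).card =
      ∑ v ∈ S, ((Γ v ∩ S).filter fun u => slot v ≤ slot u).card := by
    have e : ∀ (P : V → V → Prop) [∀ v, DecidablePred (P v)], ∑ v ∈ S, ((Γ v ∩ S).filter (P v)).card
        = ∑ v ∈ S, ∑ u ∈ S, if u ∈ Γ v ∧ P v u then 1 else 0 := by
      intro P _
      refine Finset.sum_congr rfl fun v _ => ?_
      rw [← Finset.card_filter]
      congr 1
      ext u
      simp only [Finset.mem_filter, Finset.mem_inter]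
      tauto
    rw [e, e, Finset.sum_comm]
    refine Finset.sum_congr rfl fun v _ => Finset.sum_congr rfl fun u _ => ?_
    simp only [hΓ v u]
  have h₃ : ∑ v ∈ S, ((Γ v ∩ S).filter fun u => slot v ≤ slot u).card ≤ ∑ v ∈ S, D := by
    refine Finset.sum_le_sum fun v hv => le_trans (Finset.card_le_card ?_) (h v (hS hv))
    gcongr
  calc ∑ v ∈ S, (Γ v ∩ S).card ≤ _ := Finset.sum_le_sum fun v _ => h₁ v
    _ ≤ 2 * D * S.card := by
      rw [Finset.sum_add_distrib, h₂]
      simp at h₃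
      linarith

/-- Markov's inequality: the average degree inside `S` is at most `2 * D`, and the threshold exceeds
`9 * D / 4`, which leaves a fraction of at most `8 / 9`. -/
theorem Sparse.card_filter_le {D d : ℕ} (h : Sparse Γ U D) (hd : 9 * D < 4 * (d + 1)) {S : Finset V}
    (hS : S ⊆ U) : 9 * (S.filter fun v => d < (Γ v ∩ S).card).card ≤ 8 * S.card := by
  have h₁ : (S.filter fun v => d < (Γ v ∩ S).card).card * (d + 1) ≤ 2 * D * S.card := by
    refine le_trans ?_ (h S hS)
    rw [← smul_eq_mul, ← Finset.sum_const]
    calc _ ≤ ∑ v ∈ S.filter fun v => d < (Γ v ∩ S).card, (Γ v ∩ S).card :=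
          Finset.sum_le_sum fun v hv => (Finset.mem_filter.1 hv).2
      _ ≤ _ := Finset.sum_le_sum_of_subset (Finset.filter_subset _ _)
  rcases Nat.eq_zero_or_pos S.card with h0 | h0
  · have := Finset.card_le_card (Finset.filter_subset (fun v => d < (Γ v ∩ S).card) S)
    omega
  · by_contra! hc
    nlinarith

/-! ### The local ratio argument -/

/-- Both sides are compared with `∑ v ∈ U, y v`. Summing `hq` over `U` counts each `y u` once and
then `1 / (T + 1)` times for each of at most `d` later neighbors. Summing `hy` over `J` counts each
nonzero `y u` with total factor at least `1`: either `u ∈ J`, or at least `T + 1` later neighbors in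
`J` contribute `1 / (T + 1)` each. -/
theorem local_ratio (hΓ : ∀ v u, u ∈ Γ v ↔ v ∈ Γ u) (slot : V → ℕ) (w y : V → ℝ≥0) {d T : ℕ}
    {q : ℝ≥0} {J : Finset V} (hJ : J ⊆ U)
    (hd : ∀ v ∈ U, ((Γ v ∩ U).filter fun u => slot v < slot u).card ≤ d)
    (hq : ∀ v ∈ U, q * w v ≤ y v +
      (T + 1 : ℝ≥0)⁻¹ * ∑ u ∈ (Γ v ∩ U).filter fun u => slot u < slot v, y u)
    (hy : ∀ v ∈ J, y v +
      (T + 1 : ℝ≥0)⁻¹ * ∑ u ∈ (Γ v ∩ U).filter fun u => slot u < slot v, y u ≤ w v)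
    (hjoin : ∀ v ∈ U, v ∉ J → y v = 0 ∨
      T + 1 ≤ ((Γ v ∩ J).filter fun u => slot v < slot u).card) :
    q * ∑ v ∈ U, w v ≤ (1 + d * (T + 1 : ℝ≥0)⁻¹) * ∑ v ∈ J, w v := by
  -- Double counting: instead of what each node of `A` receives, record to how many nodes of `A`
  -- each `y u` is sent.
  have swap : ∀ A ⊆ U, ∑ v ∈ A, ∑ u ∈ (Γ v ∩ U).filter (fun u => slot u < slot v), y u =
      ∑ u ∈ U, ((Γ u ∩ A).filter fun v => slot u < slot v).card * y u := by
    intro A hA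
    have e₁ : ∀ v ∈ A, ∑ u ∈ (Γ v ∩ U).filter (fun u => slot u < slot v), y u =
        ∑ u ∈ U, if u ∈ Γ v ∧ slot u < slot v then y u else 0 := by
      intro v _
      rw [← Finset.sum_filter]
      congr 1
      ext u
      simp only [Finset.mem_filter, Finset.mem_inter]
      tauto
    have e₂ : ∀ u ∈ U, (((Γ u ∩ A).filter fun v => slot u < slot v).card : ℝ≥0) * y u =
        ∑ v ∈ A, if u ∈ Γ v ∧ slot u < slot v then y u else 0 := by
      intro u _
      rw [← Finset.sum_filter, Finset.sum_const, nsmul_eq_mul]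
      congr 3
      ext v
      simp only [Finset.mem_filter, Finset.mem_inter, hΓ v u]
      tauto
    rw [Finset.sum_congr rfl e₁, Finset.sum_congr rfl e₂, Finset.sum_comm]
  set θ := (T + 1 : ℝ≥0)⁻¹ with hθ
  have hT : ((T + 1 : ℕ) : ℝ≥0) * θ = 1 := by
    rw [hθ]; push_cast
    exact mul_inv_cancel₀ (by positivity)
  have upper : q * ∑ v ∈ U, w v ≤ (1 + d * θ) * ∑ v ∈ U, y v := by
    rw [Finset.mul_sum]
    refine (Finset.sum_le_sum hq).trans ?_
    rw [Finset.sum_add_distrib, ← Finset.mul_sum, swap U subset_rfl, add_mul, one_mul, mul_comm _ θ,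
      mul_assoc, Finset.mul_sum (a := (d : ℝ≥0))]
    gcongr with v hv
    exact hd v hv
  refine upper.trans ?_
  gcongr
  refine le_trans ?_ (Finset.sum_le_sum hy)
  have hJU : ∑ v ∈ J, y v = ∑ v ∈ U, if v ∈ J then y v else 0 := by
    rw [← Finset.sum_filter, Finset.filter_mem_eq_inter, Finset.inter_eq_right.2 hJ]
  rw [Finset.sum_add_distrib, ← Finset.mul_sum, swap J hJ, Finset.mul_sum, hJU,
    ← Finset.sum_add_distrib]
  refine Finset.sum_le_sum fun v hv => ?_
  by_cases hvJ : v ∈ J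
  · simp [hvJ]
  · rcases hjoin v hv hvJ with h0 | h0
    · simp [h0]
    · calc y v = θ * (((T + 1 : ℕ) : ℝ≥0) * y v) := by rw [← mul_assoc, mul_comm θ, hT, one_mul]
        _ ≤ θ * ((((Γ v ∩ J).filter fun u => slot v < slot u).card : ℝ≥0) * y v) := by gcongr
        _ ≤ _ := le_add_self

end Sparse

theorem List.countP_map_toFinset {V β : Type*} [DecidableEq V] {l : List V} (hl : l.Nodup)
    (F : V → β) (p : β → Prop) [DecidablePred p] :
    (l.map F).countP (fun x => p x) = (l.toFinset.filter fun u => p (F u)).card := by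
  rw [List.countP_map, List.countP_eq_length_filter,
    ← List.toFinset_card_of_nodup (hl.filter _)]
  congr 1
  ext u
  simp

/-! ### Peeling off nodes of low degree -/

/-- In each of `h` rounds, the remaining nodes with at most `d` remaining neighbors are removed; the
result is the round of removal. -/
def peel (alive : Bool) (d h : ℕ) : Proc ℕ :=
  Proc.loop (fun i s => if alive = true ∧ s = i then 1 else 0)
    (fun i s l => if s = i ∧ d < l.sum then i + 1 else s) 0 h

section Protocols

variable {V : Type} [DecidableEq V] {nbrs : V → List V} {U : Finset V} {b : ℕ}

theorem peel_spec (hnd : ∀ v, (nbrs v).Nodup) (hb : 1 ≤ b) {D d h : ℕ}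
    (hsp : Sparse (fun v => (nbrs v).toFinset) U D) (hd : 9 * D < 4 * (d + 1))
    (hh : 8 ^ h * U.card < 9 ^ h) :
    ∃ lay : V → ℕ, Proc.Runs nbrs b h (fun v => peel (decide (v ∈ U)) d h) lay ∧
      (∀ v ∈ U, lay v < h) ∧
      ∀ v ∈ U, (((nbrs v).toFinset ∩ U).filter fun u => lay v ≤ lay u).card ≤ d := by
  let m : V → ℕ → ℕ → ℕ := fun v i s => if decide (v ∈ U) = true ∧ s = i then 1 else 0
  let f : V → ℕ → ℕ → List ℕ → ℕ := fun _ i s l => if s = i ∧ d < l.sum then i + 1 else s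
  set σ := Proc.globalState nbrs m f (fun _ => 0) with hσ
  -- The state equals the round number exactly while a node remains; on removal it freezes at the
  -- round of removal.
  let A : ℕ → Finset V := fun i => U.filter fun v => σ i v = i
  have step : ∀ i v, σ (i + 1) v =
      if σ i v = i ∧ d < ((nbrs v).toFinset ∩ A i).card then i + 1 else σ i v := by
    intro i v
    have : (((nbrs v).map fun u => m u i (σ i u)).sum) = ((nbrs v).toFinset ∩ A i).card := by
      rw [← List.sum_toFinset _ (hnd v), Finset.card_eq_sum_ones, ← Finset.filter_mem_eq_inter,
        Finset.sum_filter]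
      simp [m, A]
    rw [← this]
    rfl
  have le : ∀ i v, σ i v ≤ i := by
    intro i v
    induction i with
    | zero => exact le_rfl
    | succ i ih => rw [step]; split_ifs <;> omega
  have mono : ∀ v, Monotone fun i => σ i v := by
    refine fun v => monotone_nat_of_le_succ fun i => ?_
    simp only [step]
    split_ifs <;> omega
  have stable : ∀ v i j, i ≤ j → σ i v < i → σ j v = σ i v := by
    intro v i j hij hi
    induction j, hij using Nat.le_induction with
    | base => rfl
    | succ j hij ih => rw [step, if_neg (by omega), ih]
  have card : ∀ i, 9 ^ i * (A i).card ≤ 8 ^ i * U.card := by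
    intro i
    induction i with
    | zero => simpa using Finset.card_le_card (Finset.filter_subset _ U)
    | succ i ih =>
      have h₁ : A (i + 1) ⊆ (A i).filter fun v => d < ((nbrs v).toFinset ∩ A i).card := by
        intro v hv
        have hv' := Finset.mem_filter.1 hv
        have h₂ := hv'.2
        have := le i v
        rw [step] at h₂
        split_ifs at h₂ with hc
        · simp [A, hv'.1, hc.1, hc.2]
        · omega
      have h₃ : 9 * ((A i).filter fun v => d < ((nbrs v).toFinset ∩ A i).card).card ≤ 8 * (A i).card :=
        hsp.card_filter_le hd (Finset.filter_subset _ U : A i ⊆ U)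
      have h₄ := Finset.card_le_card h₁
      calc 9 ^ (i + 1) * (A (i + 1)).card = 9 ^ i * (9 * (A (i + 1)).card) := by ring
        _ ≤ 9 ^ i * (8 * (A i).card) := by
            exact Nat.mul_le_mul_left _ (by omega)
        _ = 8 * (9 ^ i * (A i).card) := by ring
        _ ≤ 8 * (8 ^ i * U.card) := by gcongr
        _ = _ := by ring
  -- A survivor of all `h` rounds would give `9 ^ h ≤ 8 ^ h * U.card`.
  have lt : ∀ v ∈ U, σ h v < h := by
    intro v hv
    refine lt_of_le_of_ne (le h v) fun hc => ?_
    have h₁ : 0 < (A h).card := Finset.card_pos.2 ⟨v, by simp [A, hv, hc]⟩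
    have := card h
    nlinarith [Nat.pos_of_ne_zero (pow_ne_zero h (by norm_num : (9 : ℕ) ≠ 0))]
  have active : ∀ j v, j < h → j ≤ σ h v → σ j v = j := by
    intro j v hj hv
    by_contra hc
    have := stable v j h hj.le (lt_of_le_of_ne (le j v) hc)
    have := le j v
    omega
  refine ⟨σ h, Proc.Runs.loop m f _ h fun i _ v => ?_, lt, fun v hv => ?_⟩
  · have : 2 ≤ 2 ^ b := Nat.le_self_pow (by omega) 2
    simp only [m]
    split_ifs <;> omega
  · have hj := lt v hv
    have h₁ := active _ v hj le_rfl
    have h₂ : ¬ d < ((nbrs v).toFinset ∩ A (σ h v)).card := by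
      intro hc
      have h₃ := mono v (show σ h v + 1 ≤ h from hj)
      simp only [step, h₁, hc, and_self, if_true] at h₃
      omega
    refine le_trans (Finset.card_le_card fun u hu => ?_) (not_lt.1 h₂)
    simp only [Finset.mem_filter, Finset.mem_inter] at hu ⊢
    simp only [A, Finset.mem_filter]
    exact ⟨hu.1.1, hu.1.2, active _ u hj hu.2⟩

/-! ### Defective coloring -/

/-- Evaluate at `x` modulo `q` the linear polynomial encoded by the two base-`r` digits of `c`. -/
def digitHash (r q x c : ℕ) : ℕ := (c / r + c % r * x) % q

/-- Distinct colors have distinct digit pairs, hence give distinct linear polynomials over the field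
with `q` elements (`r < q` keeps the digits distinct). Two such polynomials agree in at most one
point. -/
theorem eq_of_digitHash_eq {r q c c' x x' : ℕ} (hq : q.Prime) (hr : r < q) (hc : c < r ^ 2)
    (hc' : c' < r ^ 2) (hx : x < q) (hx' : x' < q) (hne : c ≠ c')
    (h : digitHash r q x c = digitHash r q x c') (h' : digitHash r q x' c = digitHash r q x' c') :
    x = x' := by
  have := Fact.mk hq
  have inj : ∀ {a a' : ℕ}, a < q → a' < q → (a : ZMod q) = a' → a = a' := by
    intro a a' ha ha' h
    have := (ZMod.natCast_eq_natCast_iff' _ _ _).1 h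
    rwa [Nat.mod_eq_of_lt ha, Nat.mod_eq_of_lt ha'] at this
  have hr0 : 0 < r := by
    rcases Nat.eq_zero_or_pos r with rfl | h
    · simp at hc
    · exact h
  have e := (ZMod.natCast_eq_natCast_iff' _ _ _).2 h
  have e' := (ZMod.natCast_eq_natCast_iff' _ _ _).2 h'
  push_cast at e e'
  have m₁ : ((((c % r : ℕ) : ZMod q) - (c' % r : ℕ)) * ((x : ZMod q) - x')) = 0 := by
    linear_combination e - e'
  rcases mul_eq_zero.1 m₁ with h0 | h0
  · exfalso
    have hm : c % r = c' % r := inj ((Nat.mod_lt _ hr0).trans hr) ((Nat.mod_lt _ hr0).trans hr)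
      (sub_eq_zero.1 h0)
    rw [hm] at e
    have hdiv : c / r = c' / r := by
      refine inj (lt_trans ?_ hr) (lt_trans ?_ hr) (by linear_combination e)
      · exact Nat.div_lt_of_lt_mul (by rwa [← sq])
      · exact Nat.div_lt_of_lt_mul (by rwa [← sq])
    exact hne (by rw [← Nat.div_add_mod c r, ← Nat.div_add_mod c' r, hm, hdiv])
  · exact inj hx hx' (sub_eq_zero.1 h0)

/-- Averaging: each `u` of another color collides with `c` at no more than one of the `S` points, so
some point sees at most a `1 / S` fraction of `t`. -/
theorem exists_digitHash_collisions_le {ι : Type*} (t : Finset ι) (col : ι → ℕ) {r q c S : ℕ}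
    (hq : q.Prime) (hr : r < q) (hS : 0 < S) (hSq : S ≤ q) (hc : c < r ^ 2)
    (hcol : ∀ u ∈ t, col u < r ^ 2) :
    ∃ x < S, S * (t.filter fun u => col u ≠ c ∧ digitHash r q x (col u) = digitHash r q x c).card ≤
      t.card := by
  by_contra! hcon
  have h₁ : ∑ x ∈ Finset.range S,
      (t.filter fun u => col u ≠ c ∧ digitHash r q x (col u) = digitHash r q x c).card ≤ t.card := by
    simp only [Finset.card_filter]
    rw [Finset.sum_comm, Finset.card_eq_sum_ones]
    refine Finset.sum_le_sum fun u hu => ?_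
    rw [← Finset.card_filter, Finset.card_le_one]
    intro x hx x' hx'
    simp only [Finset.mem_filter, Finset.mem_range] at hx hx'
    exact eq_of_digitHash_eq hq hr (hcol u hu) hc (hx.1.trans_le hSq) (hx'.1.trans_le hSq) hx.2.1
      hx.2.2 hx'.2.2
  have h₂ : ∑ _x ∈ Finset.range S, (t.card + 1) ≤ ∑ x ∈ Finset.range S, S *
      (t.filter fun u => col u ≠ c ∧ digitHash r q x (col u) = digitHash r q x c).card :=
    Finset.sum_le_sum fun x hx => hcon x (Finset.mem_range.1 hx)
  rw [← Finset.mul_sum, Finset.sum_const, Finset.card_range, smul_eq_mul] at h₂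
  nlinarith

/-- The number of colors available when `l` steps of the color reduction are left. -/
def palette (s κ l : ℕ) : ℕ := 256 * s ^ 2 * 4 ^ l * 2 ^ (κ * 2 ^ l)

/-- The base for the digits of the colors when `l + 1` steps of the color reduction are left. -/
def paletteRoot (s κ l : ℕ) : ℕ := 16 * s * 2 ^ (l + 1) * 2 ^ (κ * 2 ^ l)

theorem paletteRoot_sq (s κ l : ℕ) : paletteRoot s κ l ^ 2 = palette s κ (l + 1) := by
  rw [paletteRoot, palette, show 4 ^ (l + 1) = 2 ^ (l + 1) * 2 ^ (l + 1) by
      rw [← mul_pow]; norm_num]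
  ring

/-- A prime between `r` and `2 * r`. -/
noncomputable def primeAbove (r : ℕ) : ℕ :=
  if h : r ≠ 0 then (Nat.exists_prime_lt_and_le_two_mul r h).choose else 2

theorem primeAbove_spec {r : ℕ} (h : r ≠ 0) :
    (primeAbove r).Prime ∧ r < primeAbove r ∧ primeAbove r ≤ 2 * r := by
  rw [primeAbove, dif_pos h]
  exact (Nat.exists_prime_lt_and_le_two_mul r h).choose_spec

/-- An evaluation point `x < S` with few collisions between the color `c` and the different colors
in a list of messages from the layer `lay`, if there is one. -/
noncomputable def evalPoint (r q S lay c : ℕ) (l : List ℕ) : ℕ :=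
  Classical.epsilon fun x => x < S ∧
    S * l.countP (fun z => (z ≠ 0 ∧ (z - 1).unpair.1 = lay) ∧ (z - 1).unpair.2 ≠ c ∧
      digitHash r q x (z - 1).unpair.2 = digitHash r q x c) ≤
    l.countP fun z => z ≠ 0 ∧ (z - 1).unpair.1 = lay

/-- One step of the color reduction, after which `l` steps are left. -/
noncomputable def recolor (s κ l lay c : ℕ) (msgs : List ℕ) : ℕ :=
  let r := paletteRoot s κ l
  let q := primeAbove r
  let x := evalPoint r q (s * 2 ^ (l + 1)) lay c msgs
  x * q + digitHash r q x c

/-- Color the nodes of each layer with a palette of size `palette s κ 0`. -/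
noncomputable def layerColor (alive : Bool) (s κ T lay c : ℕ) : Proc ℕ :=
  Proc.loop (fun _ x => if alive = true then Nat.pair lay x + 1 else 0)
    (fun i x l => recolor s κ (T - 1 - i) lay x l) c T

/-- A new color is a pair (evaluation point, value), so each step roughly takes the square root of
the palette. With `l` steps left afterwards it adds at most `d / (s * 2 ^ (l + 1))` to the defect,
and these terms form a geometric series with sum below `d / s`. -/
theorem layerColor_spec (hnd : ∀ v, (nbrs v).Nodup) {s κ T d : ℕ} (hs : 0 < s) (lay c : V → ℕ)
    (hirr : ∀ v, v ∉ nbrs v) (hinj : Function.Injective c) (hc : ∀ v, c v < palette s κ T)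
    (hd : ∀ v ∈ U, (((nbrs v).toFinset ∩ U).filter fun u => lay u = lay v).card ≤ d)
    (hb : ∀ v ∈ U, ∀ i ≤ T, ∀ x < palette s κ i, Nat.pair (lay v) x + 1 < 2 ^ b) :
    ∃ col : V → ℕ,
      Proc.Runs nbrs b T (fun v => layerColor (decide (v ∈ U)) s κ T (lay v) (c v)) col ∧
      (∀ v ∈ U, col v < palette s κ 0) ∧
      ∀ v ∈ U, s * (((nbrs v).toFinset ∩ U).filter fun u => lay u = lay v ∧ col u = col v).card ≤
        d := by
  let m : V → ℕ → ℕ → ℕ := fun v _ x => if decide (v ∈ U) = true then Nat.pair (lay v) x + 1 else 0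
  let f : V → ℕ → ℕ → List ℕ → ℕ := fun v i x l => recolor s κ (T - 1 - i) (lay v) x l
  set σ := Proc.globalState nbrs m f c with hσ
  let def' : ℕ → V → ℕ := fun i v =>
    (((nbrs v).toFinset ∩ U).filter fun u => lay u = lay v ∧ σ i u = σ i v).card
  have inv : ∀ i ≤ T, ∀ v ∈ U, σ i v < palette s κ (T - i) ∧
      -- This is the partial sum `def' ≤ d * (2 ^ i - 1) / (s * 2 ^ T)`, stated without subtraction
      -- or division.
      s * 2 ^ T * def' i v + d ≤ d * 2 ^ i := by
    intro i
    induction i with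
    | zero =>
      intro _ v _
      refine ⟨hc v, ?_⟩
      have : def' 0 v = 0 := by
        refine Finset.card_eq_zero.2 (Finset.filter_eq_empty_iff.2 fun u hu h => ?_)
        have huv : u = v := hinj h.2
        subst huv
        exact hirr u (List.mem_toFinset.1 (Finset.mem_inter.1 hu).1)
      simp [this]
    | succ i ih =>
      intro hi
      replace ih := ih (by omega)
      obtain ⟨l, hl⟩ : ∃ l, T - i = l + 1 := ⟨T - i - 1, by omega⟩
      have hl' : T - (i + 1) = l := by omega
      have hl'' : T - 1 - i = l := by omega
      have hTl : 2 ^ T = 2 ^ (l + 1) * 2 ^ i := by rw [← pow_add]; congr 1; omega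
      rw [hl']
      rw [hl] at ih
      set r := paletteRoot s κ l with hr
      have hr0 : r ≠ 0 := by rw [hr, paletteRoot]; positivity
      obtain ⟨hq, hrq, hq2⟩ := primeAbove_spec hr0
      set q := primeAbove r with hqdef
      set S := s * 2 ^ (l + 1) with hS
      have hS0 : 0 < S := by positivity
      have hSr : 16 * S * 2 ^ (κ * 2 ^ l) = r := by rw [hr, paletteRoot, hS]; ring
      have hone : 1 ≤ 2 ^ (κ * 2 ^ l) := Nat.one_le_two_pow
      have hSq : S ≤ q := by nlinarith
      let x : V → ℕ := fun v => evalPoint r q S (lay v) (σ i v) ((nbrs v).map fun u => m u i (σ i u))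
      have hstep : ∀ v, σ (i + 1) v = x v * q + digitHash r q (x v) (σ i v) := by
        intro v
        have : σ (i + 1) v = recolor s κ (T - 1 - i) (lay v) (σ i v)
          ((nbrs v).map fun u => m u i (σ i u)) := rfl
        rw [this, hl'']
        rfl
      have hx : ∀ v ∈ U, x v < S ∧ S * ((((nbrs v).toFinset ∩ U).filter fun u => lay u = lay v).filter
          fun u => σ i u ≠ σ i v ∧ digitHash r q (x v) (σ i u) = digitHash r q (x v) (σ i v)).card ≤
          (((nbrs v).toFinset ∩ U).filter fun u => lay u = lay v).card := by
        intro v hv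
        -- Nodes outside `U` broadcast `0` and all others a positive number, so counting nonzero
        -- messages sees precisely the neighbors in `U`.
        have e₁ : ∀ z, ((nbrs v).map fun u => m u i (σ i u)).countP (fun y =>
            (y ≠ 0 ∧ (y - 1).unpair.1 = lay v) ∧ (y - 1).unpair.2 ≠ σ i v ∧
              digitHash r q z (y - 1).unpair.2 = digitHash r q z (σ i v)) =
            ((((nbrs v).toFinset ∩ U).filter fun u => lay u = lay v).filter
              fun u => σ i u ≠ σ i v ∧ digitHash r q z (σ i u) = digitHash r q z (σ i v)).card := by
          intro z
          rw [List.countP_map_toFinset (hnd v)]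
          congr 1
          ext u
          by_cases hu : u ∈ U <;> simp [m, hu, and_assoc]
        have e₂ : ((nbrs v).map fun u => m u i (σ i u)).countP (fun y =>
            y ≠ 0 ∧ (y - 1).unpair.1 = lay v) =
            (((nbrs v).toFinset ∩ U).filter fun u => lay u = lay v).card := by
          rw [List.countP_map_toFinset (hnd v)]
          congr 1
          ext u
          by_cases hu : u ∈ U <;> simp [m, hu]
        obtain ⟨z, hz⟩ := exists_digitHash_collisions_le (q := q) (S := S) (r := r) (c := σ i v)
          (((nbrs v).toFinset ∩ U).filter fun u => lay u = lay v) (σ i) hq hrq hS0 hSq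
          (by rw [hr, paletteRoot_sq]; exact (ih v hv).1) fun u hu => by
            rw [hr, paletteRoot_sq]
            exact (ih u (Finset.mem_inter.1 (Finset.mem_filter.1 hu).1).2).1
        rw [← e₁, ← e₂] at hz
        have := Classical.epsilon_spec (p := fun x => x < S ∧
          S * ((nbrs v).map fun u => m u i (σ i u)).countP (fun z => (z ≠ 0 ∧ (z - 1).unpair.1 = lay v) ∧
          (z - 1).unpair.2 ≠ σ i v ∧ digitHash r q x (z - 1).unpair.2 = digitHash r q x (σ i v)) ≤
          ((nbrs v).map fun u => m u i (σ i u)).countP fun z => z ≠ 0 ∧ (z - 1).unpair.1 = lay v)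
          ⟨z, hz⟩
        exact ⟨this.1, (Nat.mul_le_mul_left S (e₁ (x v)).ge).trans (this.2.trans e₂.le)⟩
      have hlt : ∀ z c, digitHash r q z c < q := fun z c => Nat.mod_lt _ hq.pos
      intro v hv
      refine ⟨?_, ?_⟩
      · rw [hstep]
        calc x v * q + digitHash r q (x v) (σ i v) < (x v + 1) * q := by
              rw [add_mul, one_mul]; exact Nat.add_lt_add_left (hlt _ _) _
          _ ≤ S * (2 * r) := Nat.mul_le_mul (hx v hv).1 hq2
          _ = 128 * s ^ 2 * 4 ^ l * 2 ^ (κ * 2 ^ l) := by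
            rw [← hSr, hS, show 4 ^ l = 2 ^ l * 2 ^ l by
      rw [← mul_pow]; norm_num]; ring
          _ ≤ palette s κ l := by rw [palette]; gcongr; norm_num
      · have hdef : def' (i + 1) v ≤ def' i v +
            ((((nbrs v).toFinset ∩ U).filter fun u => lay u = lay v).filter fun u =>
              σ i u ≠ σ i v ∧ digitHash r q (x v) (σ i u) = digitHash r q (x v) (σ i v)).card := by
          refine le_trans (Finset.card_le_card fun u hu => ?_) (Finset.card_union_le _ _)
          simp only [Finset.mem_filter, Finset.mem_union] at hu ⊢
          obtain ⟨hu, hlay, hcol⟩ := hu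
          rw [hstep, hstep] at hcol
          -- Division by `q` recovers the evaluation point from the new color. Hence a new conflict
          -- is a collision at the point chosen by `v` itself, and the choices of its neighbors do
          -- no harm.
          have hxx : x u = x v := by
            have := congrArg (· / q) hcol
            simpa [Nat.add_div_of_dvd_right, Nat.mul_add_div hq.pos, mul_comm _ q,
              Nat.div_eq_of_lt (hlt _ _)] using this
          rw [hxx] at hcol
          by_cases hσ' : σ i u = σ i v
          · exact Or.inl ⟨hu, hlay, hσ'⟩
          · exact Or.inr ⟨⟨hu, hlay⟩, hσ', by omega⟩
        have h₁ := (ih v hv).2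
        have h₂ := (hx v hv).2.trans (hd v hv)
        generalize Finset.card (Finset.filter (fun u => σ i u ≠ σ i v ∧
          digitHash r q (x v) (σ i u) = digitHash r q (x v) (σ i v)) _) = C at hdef h₂
        calc s * 2 ^ T * def' (i + 1) v + d ≤ s * 2 ^ T * (def' i v + C) + d := by gcongr
          _ = (s * 2 ^ T * def' i v + d) + 2 ^ i * (S * C) := by rw [hTl, hS]; ring
          _ ≤ d * 2 ^ i + 2 ^ i * d := by gcongr
          _ = d * 2 ^ (i + 1) := by ring
  refine ⟨σ T, Proc.Runs.loop m f _ T fun i hi v => ?_, fun v hv => ?_, fun v hv => ?_⟩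
  · change m v i (σ i v) < _
    by_cases hv : v ∈ U
    · have e : m v i (σ i v) = Nat.pair (lay v) (σ i v) + 1 := by simp [m, hv]
      rw [e]
      exact hb v hv _ (Nat.sub_le T i) _ (inv i hi.le v hv).1
    · simp [m, hv]
  · simpa using (inv T le_rfl v hv).1
  · have h₁ := (inv T le_rfl v hv).2
    have h₂ : 0 < 2 ^ T := by positivity
    have h₃ : 2 ^ T * (s * def' T v) ≤ 2 ^ T * d := by nlinarith
    exact Nat.le_of_mul_le_mul_left h₃ h₂

/-! ### Sweeping over the nodes -/

/-- For `N` rounds, every node adds up the values `φ` of the numbers received. In round `slot` a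
node broadcasts a number that is computed by `g` from this sum, which is also the result. -/
def sweep {E : Type} [AddCommMonoid E] (alive : Bool) (slot N : ℕ) (φ : ℕ → E) (g : E → ℕ) :
    Proc ℕ :=
  (Proc.loop (fun i x => if alive = true ∧ slot = i then g x.1 else 0)
    (fun i x l => (x.1 + (l.map φ).sum, if alive = true ∧ slot = i then g x.1 else x.2))
    ((0 : E), 0) N).bind fun x => Proc.pure x.2

/-- Outside its own slot a node broadcasts `0`, which `φ` ignores. When its slot arrives, a node has
therefore accumulated exactly the values of its neighbors with smaller slots. -/
theorem sweep_spec {E : Type} [AddCommMonoid E] (hnd : ∀ v, (nbrs v).Nodup) (slot : V → ℕ) (N : ℕ)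
    (φ : ℕ → E) (hφ : φ 0 = 0) (g : V → E → ℕ) (hslot : ∀ v ∈ U, slot v < N)
    (hb : ∀ v ∈ U, ∀ e, g v e < 2 ^ b) :
    ∃ out : V → ℕ,
      Proc.Runs nbrs b N (fun v => sweep (decide (v ∈ U)) (slot v) N φ (g v)) out ∧
      (∀ v ∉ U, out v = 0) ∧
      ∀ v ∈ U, out v =
        g v (∑ u ∈ ((nbrs v).toFinset ∩ U).filter fun u => slot u < slot v, φ (out u)) := by
  let m : V → ℕ → E × ℕ → ℕ := fun v i x =>
    if decide (v ∈ U) = true ∧ slot v = i then g v x.1 else 0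
  let f : V → ℕ → E × ℕ → List ℕ → E × ℕ := fun v i x l =>
    (x.1 + (l.map φ).sum, if decide (v ∈ U) = true ∧ slot v = i then g v x.1 else x.2)
  set σ := Proc.globalState nbrs m f (fun _ => (0, 0)) with hσ
  let val : V → ℕ := fun v => if v ∈ U then g v (σ (slot v) v).1 else 0
  have hm : ∀ i u, m u i (σ i u) = if u ∈ U ∧ slot u = i then val u else 0 := by
    intro i u
    by_cases hu : u ∈ U
    · by_cases hi : slot u = i
      · subst hi; simp [m, val, hu]
      · simp [m, hi]
    · simp [m, hu]
  have h₁ : ∀ i v, (σ i v).1 =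
      ∑ u ∈ ((nbrs v).toFinset ∩ U).filter fun u => slot u < i, φ (val u) := by
    intro i v
    induction i with
    | zero => simp [σ, Proc.globalState]
    | succ i ih =>
      have : (σ (i + 1) v).1 =
        (σ i v).1 + (((nbrs v).map fun u => m u i (σ i u)).map φ).sum := rfl
      rw [this, ih, List.map_map, ← List.sum_toFinset _ (hnd v), ← Finset.filter_mem_eq_inter,
        Finset.filter_filter, Finset.filter_filter, Finset.sum_filter, Finset.sum_filter,
        ← Finset.sum_add_distrib]
      refine Finset.sum_congr rfl fun u _ => ?_
      simp only [Function.comp, hm]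
      by_cases hu : u ∈ U
      · rcases lt_trichotomy (slot u) i with h | h | h
        · simp [hu, h, h.ne, hφ, h.trans (Nat.lt_succ_self i)]
        · simp [hu, h]
        · simp [hu, h.ne', hφ, h.not_gt, show ¬ slot u < i + 1 by omega]
      · simp [hu, hφ]
  have h₂ : ∀ i v, (σ i v).2 = if v ∈ U ∧ slot v < i then val v else 0 := by
    intro i v
    induction i with
    | zero => simp [σ, Proc.globalState]
    | succ i ih =>
      have : (σ (i + 1) v).2 =
        if decide (v ∈ U) = true ∧ slot v = i then g v (σ i v).1 else (σ i v).2 := rfl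
      rw [this, ih]
      by_cases hv : v ∈ U
      · rcases lt_trichotomy (slot v) i with h | h | h
        · simp [hv, h, h.ne, h.trans (Nat.lt_succ_self i)]
        · subst h; simp [hv, val]
        · simp [hv, h.ne', h.not_gt, show ¬ slot v < i + 1 by omega]
      · simp [hv]
  have h₃ : ∀ v, (σ N v).2 = val v := by
    intro v
    rw [h₂]
    by_cases hv : v ∈ U
    · simp [hv, hslot v hv]
    · simp [hv, val]
  refine ⟨val, ?_, fun v hv => if_neg hv, fun v hv => ?_⟩
  · refine Proc.Runs.bind (t' := 0) (Q := fun _ x => Proc.pure x.2)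
      (Proc.Runs.loop m f (fun _ => (0, 0)) N fun i _ v => ?_) ?_
    · simp only [m]
      split_ifs with h
      · exact hb v (by simpa using h.1) _
      · positivity
    · have := Proc.Runs.pure (nbrs := nbrs) (b := b) val
      convert this using 2 with v
      rw [← h₃ v]
  · rw [← h₁]
    exact if_pos hv

end Protocols

/-! ### Encoding of weights -/

/-- The number with binary expansion `l`, least significant bit first, and an additional leading
bit `1`. -/
def bitCode (l : List Bool) : ℕ := l.foldr Nat.bit 1

theorem bitCode_pos (l : List Bool) : 0 < bitCode l := by
  induction l with
  | nil => exact one_pos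
  | cons b l ih =>
    simp only [bitCode, List.foldr_cons, Nat.bit_val] at ih ⊢
    omega

/-- The leading `1` marks the end of the string, so that trailing zeros are not lost. -/
theorem bitCode_injective : Function.Injective bitCode := by
  intro l
  induction l with
  | nil =>
    rintro (_ | ⟨b, l'⟩) h
    · rfl
    · have := bitCode_pos l'
      simp only [bitCode, List.foldr_cons, List.foldr_nil, Nat.bit_val] at h this
      omega
  | cons b l ih =>
    rintro (_ | ⟨b', l'⟩) h
    · have := bitCode_pos l
      simp only [bitCode, List.foldr_cons, List.foldr_nil, Nat.bit_val] at h this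
      omega
    · have h' : 2 * bitCode l + b.toNat = 2 * bitCode l' + b'.toNat := by
        simpa only [bitCode, List.foldr_cons, Nat.bit_val] using h
      have hb := Bool.toNat_lt b
      have hb' := Bool.toNat_lt b'
      have hbb : b.toNat = b'.toNat := by omega
      rw [ih (a₂ := l') (by omega)]
      cases b <;> cases b' <;> simp_all

theorem bitCode_lt (l : List Bool) : bitCode l < 2 ^ (l.length + 1) := by
  induction l with
  | nil => simp [bitCode]
  | cons b l ih =>
    simp only [bitCode, List.foldr_cons, List.length_cons, Nat.bit_val, pow_succ] at ih ⊢
    have := Bool.toNat_lt b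
    omega

/-- A representation of `x` with at most `k` bits in the number format `dec`, if there is one. -/
noncomputable def weightCode (dec : List Bool → ℝ≥0) (k : ℕ) (x : ℝ≥0) : List Bool :=
  Classical.epsilon fun s => s.length ≤ k ∧ dec s = x

/-- The message by which a node of weight `x` announces its push: its weight, and the part of the
weight, in multiples of `1 / 64`, which is not covered by the sum `acc` of the pushes received. -/
noncomputable def pushCode (dec : List Bool → ℝ≥0) (k T : ℕ) (x acc : ℝ≥0) : ℕ :=
  Nat.pair (bitCode (weightCode dec k x)) ⌊64 * (x - (T + 1 : ℝ≥0)⁻¹ * acc) / x⌋₊ + 1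

/-- The value of a push message. -/
noncomputable def pushValue (dec : List Bool → ℝ≥0) (z : ℕ) : ℝ≥0 :=
  if z = 0 then 0 else
    dec (Function.invFun bitCode (z - 1).unpair.1) * ((z - 1).unpair.2 : ℝ≥0) / 64

section Push

variable {dec : List Bool → ℝ≥0} {k : ℕ} {x : ℝ≥0}

theorem weightCode_spec (hx : ∃ s : List Bool, s.length ≤ k ∧ dec s = x) :
    (weightCode dec k x).length ≤ k ∧ dec (weightCode dec k x) = x :=
  Classical.epsilon_spec (p := fun s : List Bool => s.length ≤ k ∧ dec s = x) hx

theorem pushValue_pushCode (hx : ∃ s : List Bool, s.length ≤ k ∧ dec s = x) (T : ℕ) (acc : ℝ≥0) :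
    pushValue dec (pushCode dec k T x acc) =
      x * (⌊64 * (x - (T + 1 : ℝ≥0)⁻¹ * acc) / x⌋₊ : ℝ≥0) / 64 := by
  simp [pushValue, pushCode, Function.leftInverse_invFun bitCode_injective _,
    (weightCode_spec hx).2]

theorem pushCode_lt (hx : ∃ s : List Bool, s.length ≤ k ∧ dec s = x) {T b : ℕ} {acc : ℝ≥0}
    (hb : ∀ a < 2 ^ (k + 1), ∀ j ≤ 64, Nat.pair a j + 1 < 2 ^ b) :
    pushCode dec k T x acc < 2 ^ b := by
  refine hb _ ((bitCode_lt _).trans_le (Nat.pow_le_pow_right (by norm_num)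
    (Nat.succ_le_succ (weightCode_spec hx).1))) _ ?_
  refine Nat.floor_le_of_le ?_
  -- For weight zero, division by zero yields the multiple `0`.
  rcases eq_or_ne x 0 with rfl | h0
  · simp
  · rw [div_le_iff₀ (pos_iff_ne_zero.2 h0)]
    push_cast
    gcongr
    exact tsub_le_self

/-- A nonzero push means that the truncated difference did not vanish, so the received part is at
most `x`; rounding down only helps. -/
theorem pushValue_add_le (hx : ∃ s : List Bool, s.length ≤ k ∧ dec s = x) (T : ℕ) (acc : ℝ≥0)
    (h : pushValue dec (pushCode dec k T x acc) ≠ 0) :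
    pushValue dec (pushCode dec k T x acc) + (T + 1 : ℝ≥0)⁻¹ * acc ≤ x := by
  rw [pushValue_pushCode hx] at h ⊢
  set a := (T + 1 : ℝ≥0)⁻¹ * acc
  have h0 : x ≠ 0 := by rintro rfl; simp at h
  have hle : a ≤ x := by
    by_contra hc
    rw [tsub_eq_zero_of_le (not_le.1 hc).le] at h
    simp at h
  have h₁ := Nat.floor_le (show 0 ≤ 64 * (x - a) / x from zero_le)
  calc x * (⌊64 * (x - a) / x⌋₊ : ℝ≥0) / 64 + a ≤ x * (64 * (x - a) / x) / 64 + a := by gcongr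
    _ = (x - a) + a := by field_simp
    _ = x := tsub_add_cancel_of_le hle

/-- Rounding down to a multiple of `x / 64` loses at most `x / 64`. This is the source of the factor
`64 / 63` in the loss. -/
theorem le_pushValue_add (hx : ∃ s : List Bool, s.length ≤ k ∧ dec s = x) (T : ℕ) (acc : ℝ≥0) :
    63 / 64 * x ≤ pushValue dec (pushCode dec k T x acc) + (T + 1 : ℝ≥0)⁻¹ * acc := by
  rw [pushValue_pushCode hx]
  set a := (T + 1 : ℝ≥0)⁻¹ * acc
  rcases eq_or_ne x 0 with rfl | h0
  · simp
  have h₁ := (Nat.lt_floor_add_one (64 * (x - a) / x)).le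
  set j : ℝ≥0 := (⌊64 * (x - a) / x⌋₊ : ℝ≥0)
  have h₂ : 64 * (x - a) ≤ (j + 1) * x := by
    rwa [div_le_iff₀ (pos_iff_ne_zero.2 h0)] at h₁
  have h₃ : x ≤ (x - a) + a := le_tsub_add
  rw [← NNReal.coe_le_coe] at h₂ h₃ ⊢
  push_cast at h₂ h₃ ⊢
  linarith

end Push

/-! ### Reducing the sparsity -/

/-- The threshold for peeling. -/
def peelDegree (D : ℕ) : ℕ := 9 * D / 4

/-- The number of later neighbors that a node tolerates. -/
def tolerance (m D : ℕ) : ℕ := peelDegree D / (64 * m)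

/-- The sparsity after one stage. -/
def nextSparsity (m D : ℕ) : ℕ := tolerance m D + peelDegree D / (2048 * m)

/-- The number of rounds of a sweep. -/
def sweepRounds (κ L m : ℕ) : ℕ := 6 * L * palette (2048 * m) κ 0

/-- The number of rounds of a stage. -/
def stageRounds (κ L m : ℕ) : ℕ := 6 * L + (L.size + (sweepRounds κ L m + (sweepRounds κ L m + 0)))

/-- The factor by which the weight decreases in a stage. -/
noncomputable def stageLoss (m D : ℕ) : ℝ≥0 :=
  64 / 63 * (1 + peelDegree D * (tolerance m D + 1 : ℝ≥0)⁻¹)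

/-- One stage: find a sparser subset of nonnegligible weight. -/
noncomputable def stage (dec : List Bool → ℝ≥0) (κ L m i : ℕ) (x : ℝ≥0) (D : ℕ) (alive : Bool) :
    Proc Bool :=
  (peel alive (peelDegree D) (6 * L)).bind fun lay =>
  (layerColor alive (2048 * m) κ L.size lay i).bind fun col =>
  (sweep alive (lay * palette (2048 * m) κ 0 + col) (sweepRounds κ L m) (pushValue dec)
    (pushCode dec (κ * L) (tolerance m D) x)).bind fun z =>
  (sweep alive (sweepRounds κ L m - 1 - (lay * palette (2048 * m) κ 0 + col)) (sweepRounds κ L m)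
    (fun y : ℕ => y)
    (fun y : ℕ => if pushValue dec z ≠ 0 ∧ y ≤ tolerance m D then 1 else 0)).bind fun z' =>
  Proc.pure (decide (z' = 1))

/-- Run `K` stages. -/
noncomputable def stages (dec : List Bool → ℝ≥0) (κ L m i : ℕ) (x : ℝ≥0) :
    ℕ → ℕ → Bool → Proc Bool
  | 0, _, alive => Proc.pure alive
  | K + 1, D, alive => (stage dec κ L m i x D alive).bind (stages dec κ L m i x K (nextSparsity m D))

/-- The factor by which the weight decreases in `K` stages. -/
noncomputable def stagesLoss (m : ℕ) : ℕ → ℕ → ℝ≥0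
  | 0, _ => 1
  | K + 1, D => stageLoss m D * stagesLoss m K (nextSparsity m D)

section Stage

variable {V : Type} [DecidableEq V] {nbrs : V → List V} {U : Finset V} {b κ L m : ℕ}
  {dec : List Bool → ℝ≥0} {i : V → ℕ} {w : V → ℝ≥0}

theorem stage_spec (hnd : ∀ v, (nbrs v).Nodup) (hsymm : ∀ v u, u ∈ nbrs v ↔ v ∈ nbrs u)
    (hirr : ∀ v, v ∉ nbrs v) (hi : Function.Injective i) (hiL : ∀ v, i v < 2 ^ (κ * L))
    (hw : ∀ v, ∃ s : List Bool, s.length ≤ κ * L ∧ dec s = w v) (hm : 0 < m)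
    (hb₁ : ∀ a < 6 * L, ∀ l ≤ L.size, ∀ x < palette (2048 * m) κ l, Nat.pair a x + 1 < 2 ^ b)
    (hb₂ : ∀ a < 2 ^ (κ * L + 1), ∀ j ≤ 64, Nat.pair a j + 1 < 2 ^ b) (hU : U.card < 2 ^ L) {D : ℕ}
    (hsp : Sparse (fun v => (nbrs v).toFinset) U D) :
    ∃ J ⊆ U, Proc.Runs nbrs b (stageRounds κ L m)
        (fun v => stage dec κ L m (i v) (w v) D (decide (v ∈ U))) (fun v => decide (v ∈ J)) ∧
      Sparse (fun v => (nbrs v).toFinset) J (nextSparsity m D) ∧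
      ∑ v ∈ U, w v ≤ stageLoss m D * ∑ v ∈ J, w v := by
  have hb : 1 < 2 ^ b := by have := hb₂ 0 (by positivity) 0 (by norm_num); omega
  have hb0 : 1 ≤ b := by
    rcases Nat.eq_zero_or_pos b with rfl | h
    · simp at hb
    · exact h
  -- Six rounds halve the remaining set, since `8 ^ 6 * 2 ≤ 9 ^ 6`.
  have hh : 8 ^ (6 * L) * U.card < 9 ^ (6 * L) := by
    calc 8 ^ (6 * L) * U.card < 8 ^ (6 * L) * 2 ^ L := by gcongr
      _ = (8 ^ 6 * 2) ^ L := by rw [pow_mul, mul_pow]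
      _ ≤ (9 ^ 6) ^ L := Nat.pow_le_pow_left (by norm_num) L
      _ = 9 ^ (6 * L) := by rw [pow_mul]
  obtain ⟨lay, run₁, hlay, hdeg⟩ := peel_spec hnd hb0 hsp (d := peelDegree D)
    (by rw [peelDegree]; omega) hh
  -- Hence the identifiers, below `2 ^ (κ * L)`, fit into the initial palette when `L.size`
  -- reduction steps are performed.
  have hL : L < 2 ^ L.size := Nat.lt_size_self L
  obtain ⟨col, run₂, hcol, hdef⟩ := layerColor_spec (U := U) (b := b) (κ := κ) (T := L.size)
    (d := peelDegree D) hnd (show 0 < 2048 * m by positivity) lay i hirr hi (fun v => by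
      refine (hiL v).trans_le ?_
      rw [palette]
      calc 2 ^ (κ * L) ≤ 1 * 2 ^ (κ * 2 ^ L.size) := by
            rw [one_mul]; exact Nat.pow_le_pow_right (by norm_num) (Nat.mul_le_mul_left κ hL.le)
        _ ≤ _ := Nat.mul_le_mul_right _ (Nat.succ_le_of_lt (by positivity)))
    (fun v hv => le_trans (Finset.card_le_card fun u hu => by
      simp only [Finset.mem_filter] at hu ⊢
      exact ⟨hu.1, hu.2.ge⟩) (hdeg v hv))
    (fun v hv => hb₁ _ (hlay v hv))
  set M := palette (2048 * m) κ 0 with hM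
  set N := sweepRounds κ L m with hN
  let slot : V → ℕ := fun v => lay v * M + col v
  have hslot : ∀ v ∈ U, slot v < N := fun v hv => by
    calc slot v < lay v * M + M := Nat.add_lt_add_left (hcol v hv) _
      _ = (lay v + 1) * M := by ring
      _ ≤ 6 * L * M := Nat.mul_le_mul_right _ (hlay v hv)
  have hslot_lay : ∀ v ∈ U, ∀ u ∈ U, slot v ≤ slot u → lay v ≤ lay u := fun v hv u hu h => by
    by_contra! hc
    have h₁ := Nat.mul_le_mul_right M (show lay u + 1 ≤ lay v from hc)
    have h₂ := hcol u hu
    simp only [slot] at h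
    rw [add_mul, one_mul] at h₁
    omega
  have hslot_eq : ∀ v ∈ U, ∀ u ∈ U, slot u = slot v → lay u = lay v ∧ col u = col v :=
    fun v hv u hu h => by
      have h₁ := le_antisymm (hslot_lay u hu v hv h.le) (hslot_lay v hv u hu h.ge)
      simp only [slot, h₁] at h
      exact ⟨h₁, by omega⟩
  obtain ⟨z, run₃, -, hz⟩ := sweep_spec (U := U) (b := b) hnd slot N (pushValue dec)
    (by simp [pushValue]) (fun v => pushCode dec (κ * L) (tolerance m D) (w v)) hslot
    (fun v _ _ => pushCode_lt (hw v) hb₂)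
  -- Reversing the slots as `N - 1 - slot v` makes the second sweep run backward; summing its
  -- `0`/`1` messages counts the later neighbors that joined.
  obtain ⟨z', run₄, hz0, hz'⟩ := sweep_spec (U := U) (b := b) hnd (fun v => N - 1 - slot v) N
    (fun y : ℕ => y) rfl (fun v (y : ℕ) =>
      if pushValue dec (z v) ≠ 0 ∧ y ≤ tolerance m D then 1 else 0)
    (fun v hv => by have := hslot v hv; omega) (fun v _ e => by split_ifs <;> omega)
  let J := U.filter fun v => z' v = 1
  have hJU : J ⊆ U := Finset.filter_subset _ _
  have hcount : ∀ v ∈ U, (∑ u ∈ ((nbrs v).toFinset ∩ U).filter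
      (fun u => N - 1 - slot u < N - 1 - slot v), z' u) =
      (((nbrs v).toFinset ∩ J).filter fun u => slot v < slot u).card := by
    intro v hv
    rw [Finset.card_eq_sum_ones, Finset.sum_filter, Finset.sum_filter, ← Finset.filter_mem_eq_inter,
      ← Finset.filter_mem_eq_inter, Finset.sum_filter, Finset.sum_filter]
    refine Finset.sum_congr rfl fun u _ => ?_
    by_cases hu : u ∈ U
    · have h₁ := hslot v hv
      have h₂ := hslot u hu
      have h₃ : N - 1 - slot u < N - 1 - slot v ↔ slot v < slot u := by omega
      have h₄ : z' u = 1 ∨ z' u = 0 := by rw [hz' u hu]; split_ifs <;> simp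
      rcases h₄ with h₄ | h₄ <;> simp [hu, J, h₃, h₄]
    · simp [hu, J]
  have hJ : ∀ v ∈ U, (v ∈ J ↔ pushValue dec (z v) ≠ 0 ∧
      (((nbrs v).toFinset ∩ J).filter fun u => slot v < slot u).card ≤ tolerance m D) := by
    intro v hv
    have h₁ := hz' v hv
    rw [hcount v hv] at h₁
    simp only [J, Finset.mem_filter, hv, true_and] at h₁ ⊢
    rw [h₁]
    split_ifs with h <;> simp [h]
  refine ⟨J, hJU, ?_, ?_, ?_⟩
  · refine run₁.bind (run₂.bind (run₃.bind (run₄.bind (t' := 0)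
      (Q := fun _ z' => Proc.pure (decide (z' = 1))) ?_)))
    convert Proc.Runs.pure (nbrs := nbrs) (b := b) (fun v => decide (v ∈ J)) using 3 with v
    by_cases hv : v ∈ U
    · simp [J, hv]
    · simp [J, hv, hz0 v hv]
  · refine sparse_of_slots (fun v u => by simp [hsymm v u]) slot fun v hv => ?_
    have hvU := hJU hv
    -- Strictly later neighbors are limited by the joining rule, those in the same slot by the
    -- defect of the coloring.
    have h₁ : (((nbrs v).toFinset ∩ J).filter fun u => slot v ≤ slot u) ⊆
        (((nbrs v).toFinset ∩ J).filter fun u => slot v < slot u) ∪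
        (((nbrs v).toFinset ∩ U).filter fun u => lay u = lay v ∧ col u = col v) := by
      intro u hu
      simp only [Finset.mem_filter, Finset.mem_inter, Finset.mem_union] at hu ⊢
      rcases hu.2.lt_or_eq with h | h
      · exact Or.inl ⟨hu.1, h⟩
      · exact Or.inr ⟨⟨hu.1.1, hJU hu.1.2⟩, hslot_eq v hvU u (hJU hu.1.2) h.symm⟩
    refine (Finset.card_le_card h₁).trans ((Finset.card_union_le _ _).trans ?_)
    refine Nat.add_le_add ((hJ v hvU).1 hv).2 ?_
    rw [Nat.le_div_iff_mul_le (by positivity), mul_comm]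
    exact hdef v hvU
  · have key := local_ratio (Γ := fun v => (nbrs v).toFinset) (U := U) (J := J)
      (q := 63 / 64) (d := peelDegree D) (T := tolerance m D)
      (fun v u => by simp [hsymm v u]) slot w (fun v => pushValue dec (z v)) hJU
      (fun v hv => le_trans (Finset.card_le_card fun u hu => by
        simp only [Finset.mem_filter, Finset.mem_inter] at hu ⊢
        exact ⟨hu.1, hslot_lay v hv u hu.1.2 hu.2.le⟩) (hdeg v hv))
      (fun v hv => by
        rw [hz v hv]
        exact le_pushValue_add (hw v) _ _)
      (fun v hv => by
        have h₁ := ((hJ v (hJU hv)).1 hv).1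
        rw [hz v (hJU hv)] at h₁ ⊢
        exact pushValue_add_le (hw v) _ _ h₁)
      (fun v hv hvJ => by
        rw [hJ v hv, not_and_or, not_not, not_le] at hvJ
        exact hvJ)
    rw [stageLoss, mul_assoc]
    calc ∑ v ∈ U, w v = 64 / 63 * (63 / 64 * ∑ v ∈ U, w v) := by
          rw [← mul_assoc, show (64 / 63 * (63 / 64) : ℝ≥0) = 1 by norm_num, one_mul]
      _ ≤ _ := by gcongr

theorem stages_spec (hnd : ∀ v, (nbrs v).Nodup) (hsymm : ∀ v u, u ∈ nbrs v ↔ v ∈ nbrs u)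
    (hirr : ∀ v, v ∉ nbrs v) (hi : Function.Injective i) (hiL : ∀ v, i v < 2 ^ (κ * L))
    (hw : ∀ v, ∃ s : List Bool, s.length ≤ κ * L ∧ dec s = w v) (hm : 0 < m)
    (hb₁ : ∀ a < 6 * L, ∀ l ≤ L.size, ∀ x < palette (2048 * m) κ l, Nat.pair a x + 1 < 2 ^ b)
    (hb₂ : ∀ a < 2 ^ (κ * L + 1), ∀ j ≤ 64, Nat.pair a j + 1 < 2 ^ b) (K : ℕ) :
    ∀ (U : Finset V) (D : ℕ), U.card < 2 ^ L → Sparse (fun v => (nbrs v).toFinset) U D →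
    ∃ J ⊆ U, Proc.Runs nbrs b (K * stageRounds κ L m)
        (fun v => stages dec κ L m (i v) (w v) K D (decide (v ∈ U))) (fun v => decide (v ∈ J)) ∧
      Sparse (fun v => (nbrs v).toFinset) J ((nextSparsity m)^[K] D) ∧
      ∑ v ∈ U, w v ≤ stagesLoss m K D * ∑ v ∈ J, w v := by
  induction K with
  | zero =>
    intro U D _ hsp
    refine ⟨U, subset_rfl, ?_, hsp, by simp [stagesLoss]⟩
    rw [zero_mul]
    exact Proc.Runs.pure _
  | succ K ih =>
    intro U D hU hsp
    obtain ⟨J, hJ, run, hsp', hle⟩ :=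
      stage_spec hnd hsymm hirr hi hiL hw hm hb₁ hb₂ hU hsp
    obtain ⟨J', hJ', run', hsp'', hle'⟩ :=
      ih J (nextSparsity m D) ((Finset.card_le_card hJ).trans_lt hU) hsp'
    refine ⟨J', hJ'.trans hJ, ?_, hsp'', hle.trans ?_⟩
    · rw [add_mul, one_mul, add_comm]
      exact run.bind run'
    · rw [stagesLoss, mul_assoc]
      gcongr

end Stage

/-! ### Bounds on the parameters -/

theorem stageLoss_zero_le (m : ℕ) : stageLoss m 0 ≤ 5 / 2 := by
  simp only [stageLoss, peelDegree, Nat.mul_zero, Nat.zero_div, Nat.cast_zero, zero_mul, add_zero,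
    mul_one]
  rw [← NNReal.coe_le_coe]
  push_cast
  norm_num

/-- With tolerance `0` the loss is `64 / 63 * (1 + d)`, and `1 + d ≤ 3 * D`. The constant `16 / 5 =
5 / 2 * (32 / 25)` is the origin of the `32 / 25` in `stagesLoss_le`. -/
theorem stageLoss_le_of_next_eq_zero {m D : ℕ} (hD : 1 ≤ D) (h : nextSparsity m D = 0) :
    stageLoss m D ≤ 16 / 5 * D := by
  have h₁ : tolerance m D = 0 := (Nat.add_eq_zero_iff.1 h).1
  have h₂ : 1 + peelDegree D ≤ 3 * D := by rw [peelDegree]; omega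
  have h₃ : (1 : ℝ) + peelDegree D ≤ 3 * D := by exact_mod_cast h₂
  rw [stageLoss, h₁, ← NNReal.coe_le_coe]
  push_cast
  simp only [zero_add, inv_one, mul_one]
  linarith

theorem nextSparsity_eq (m D : ℕ) : nextSparsity m D = tolerance m D + tolerance m D / 32 := by
  rw [nextSparsity, tolerance, Nat.div_div_eq_div_mul]
  congr 2
  ring

/-- The new sparsity is at most `33 / 32` of the tolerance `T`, which cancels the denominator `T +
1` and leaves about `d ≤ 9 / 4 * D`. The gap up to `5 / 2` absorbs the rounding factors `64 / 63`,
`33 / 32` and `33 / 32`. -/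
theorem stageLoss_mul_next_le {m D : ℕ} (hm : 0 < m) (h : 1 ≤ nextSparsity m D) :
    stageLoss m D * nextSparsity m D ≤ 5 / 2 * D := by
  have e := nextSparsity_eq m D
  set T := tolerance m D with hT
  set N := nextSparsity m D
  set d := peelDegree D with hd
  have h₁ : 32 * N ≤ 33 * T := by omega
  have h₂ : 64 * T ≤ d := by
    calc 64 * T ≤ 64 * m * T := by nlinarith
      _ ≤ d := by rw [hT, tolerance]; exact Nat.mul_div_le _ _
  have h₃ : 4 * d ≤ 9 * D := by rw [hd, peelDegree]; omega
  have hT1 : 1 ≤ T := by omega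
  have g₁ : (32 : ℝ) * N ≤ 33 * T := by exact_mod_cast h₁
  have g₂ : (64 : ℝ) * T ≤ d := by exact_mod_cast h₂
  have g₃ : (4 : ℝ) * d ≤ 9 * D := by exact_mod_cast h₃
  have g₄ : (1 : ℝ) ≤ T := by exact_mod_cast hT1
  rw [stageLoss, ← NNReal.coe_le_coe]
  push_cast
  have hpos : (0 : ℝ) < T + 1 := by positivity
  have key : (64 : ℝ) / 63 * (T + 1 + d) * N ≤ 5 / 2 * D * (T + 1) := by
    have k₁ : (T : ℝ) + 1 + d ≤ 33 / 32 * d := by linarith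
    calc (64 : ℝ) / 63 * (T + 1 + d) * N ≤ 64 / 63 * (33 / 32 * (9 / 4 * D)) * (33 / 32 * T) := by
          gcongr <;> linarith
      _ ≤ 5 / 2 * D * (T + 1) := by
          have : (0 : ℝ) ≤ D := by positivity
          nlinarith [mul_nonneg this (by linarith : (0 : ℝ) ≤ T)]
  calc (64 : ℝ) / 63 * (1 + d * ((T : ℝ) + 1)⁻¹) * N
      = (64 / 63 * (T + 1 + d) * N) / (T + 1) := by field_simp
    _ ≤ 5 / 2 * D := by rw [div_le_iff₀ hpos]; exact key

/-- While the sparsity stays positive, the loss of a stage is at most `5 / 2` times the ratio of old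
to new sparsity, so the product telescopes. The stage reaching `0` costs `16 / 5 * D`, and every
stage after it at most `5 / 2`. -/
theorem stagesLoss_le {m : ℕ} (hm : 0 < m) (K : ℕ) :
    ∀ D, (nextSparsity m)^[K] D = 0 →
      stagesLoss m K D ≤ (5 / 2) ^ K * (if D = 0 then (1 : ℝ≥0) else 32 / 25 * D) := by
  induction K with
  | zero =>
    intro D hD
    simp only [Function.iterate_zero, id] at hD
    simp [stagesLoss, hD]
  | succ K ih =>
    intro D hD
    rw [Function.iterate_succ_apply] at hD
    have h₁ := ih _ hD
    rw [stagesLoss]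
    rcases Nat.eq_zero_or_pos D with rfl | hD0
    · have h₀ : nextSparsity m 0 = 0 := by simp [nextSparsity, tolerance, peelDegree]
      rw [h₀, if_pos rfl] at h₁
      rw [h₀, if_pos rfl, pow_succ']
      calc _ ≤ 5 / 2 * ((5 / 2) ^ K * 1) := mul_le_mul' (stageLoss_zero_le m) h₁
        _ = _ := by ring
    · rw [if_neg hD0.ne', pow_succ']
      rcases Nat.eq_zero_or_pos (nextSparsity m D) with h₀ | h₀
      · rw [h₀, if_pos rfl] at h₁
        rw [h₀]
        calc _ ≤ 16 / 5 * (D : ℝ≥0) * ((5 / 2) ^ K * 1) :=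
              mul_le_mul' (stageLoss_le_of_next_eq_zero hD0 h₀) h₁
          _ = _ := by
            rw [← NNReal.coe_inj]; push_cast; ring
      · rw [if_neg h₀.ne'] at h₁
        calc _ ≤ stageLoss m D * ((5 / 2) ^ K * (32 / 25 * (nextSparsity m D : ℝ≥0))) := by gcongr
          _ = (5 / 2) ^ K * (32 / 25) * (stageLoss m D * nextSparsity m D) := by ring
          _ ≤ (5 / 2) ^ K * (32 / 25) * (5 / 2 * D) := by
            exact mul_le_mul_right (stageLoss_mul_next_le hm h₀) _
          _ = _ := by ring

theorem nextSparsity_le_div {m : ℕ} (hm : 0 < m) (D : ℕ) : nextSparsity m D ≤ D / m := by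
  rw [nextSparsity_eq, Nat.le_div_iff_mul_le hm]
  have h₁ : 64 * m * tolerance m D ≤ 9 * D / 4 := by
    rw [tolerance, peelDegree]; exact Nat.mul_div_le _ _
  have h₂ : (tolerance m D + tolerance m D / 32) * m ≤ 2 * tolerance m D * m := by
    gcongr; omega
  have h₃ : 64 * m * tolerance m D = 32 * (2 * tolerance m D * m) := by ring
  omega

theorem nextSparsity_iterate_le {m : ℕ} (hm : 0 < m) (K D : ℕ) :
    (nextSparsity m)^[K] D ≤ D / m ^ K := by
  induction K generalizing D with
  | zero => simp
  | succ K ih =>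
    rw [Function.iterate_succ_apply]
    calc _ ≤ nextSparsity m D / m ^ K := ih _
      _ ≤ D / m / m ^ K := Nat.div_le_div_right (nextSparsity_le_div hm D)
      _ = D / m ^ (K + 1) := by rw [Nat.div_div_eq_div_mul, pow_succ']

/-- The factor by which the sparsity decreases in each of `K` stages. -/
noncomputable def stageFactor (K a : ℕ) : ℕ := ⌊(a : ℝ) ^ (1 / K : ℝ)⌋₊ + 1

theorem lt_stageFactor_pow {K : ℕ} (hK : 0 < K) (a : ℕ) : a < stageFactor K a ^ K := by
  have h₁ : (a : ℝ) ^ (1 / K : ℝ) < stageFactor K a := by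
    rw [stageFactor]; push_cast; exact Nat.lt_floor_add_one _
  have h₂ : ((a : ℝ) ^ (1 / K : ℝ)) ^ K = a := by
    rw [one_div]; exact Real.rpow_inv_natCast_pow (by positivity) hK.ne'
  have h₃ := pow_lt_pow_left₀ h₁ (by positivity) hK.ne'
  rw [h₂] at h₃
  exact_mod_cast h₃

theorem stageFactor_le {K a : ℕ} (hK : 0 < K) (ha : 0 < a) : stageFactor K a ≤ a + 1 := by
  rw [stageFactor]
  gcongr
  refine Nat.floor_le_of_le (Real.rpow_le_self_of_one_le (by exact_mod_cast ha) ?_)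
  rw [div_le_one (by positivity)]
  exact_mod_cast hK

/-- The palette is quadratic in `m`; this is why there are `2 * k` stages rather than `k`: `m ^ 2`
is then of order `a ^ (1 / k) ≤ a ^ τ`. -/
theorem stageFactor_sq_le {τ : ℝ} (hτ : 0 < τ) {a : ℕ} (ha : 0 < a) :
    (stageFactor (2 * ⌈1 / τ⌉₊) a : ℝ) ^ 2 ≤ 4 * (a : ℝ) ^ τ := by
  set k := ⌈1 / τ⌉₊ with hk
  have hk0 : 0 < k := Nat.ceil_pos.2 (by positivity)
  have ha1 : (1 : ℝ) ≤ a := by exact_mod_cast ha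
  set y := (a : ℝ) ^ (1 / (2 * k : ℕ) : ℝ) with hy
  have hy1 : 1 ≤ y := Real.one_le_rpow ha1 (by positivity)
  have h₁ : (stageFactor (2 * k) a : ℝ) ≤ 2 * y := by
    rw [stageFactor]; push_cast
    have := Nat.floor_le (show 0 ≤ y by positivity)
    rw [hy] at *
    push_cast at *
    linarith
  have h₂ : y ^ 2 ≤ (a : ℝ) ^ τ := by
    rw [hy, ← Real.rpow_natCast, ← Real.rpow_mul (by positivity)]
    refine Real.rpow_le_rpow_of_exponent_le ha1 ?_
    have h₃ : 1 / τ ≤ k := Nat.le_ceil _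
    rw [div_le_iff₀ hτ] at h₃
    push_cast
    rw [div_mul_eq_mul_div, one_mul, div_le_iff₀ (by positivity)]
    linarith
  calc (stageFactor (2 * k) a : ℝ) ^ 2 ≤ (2 * y) ^ 2 := by gcongr
    _ = 4 * y ^ 2 := by ring
    _ ≤ _ := by gcongr

/-! ### Message sizes and round counts -/

theorem pair_add_one_lt {a x e : ℕ} (ha : a < 2 ^ e) (hx : x < 2 ^ e) :
    Nat.pair a x + 1 < 2 ^ (2 * e + 1) := by
  have h₁ := Nat.pair_lt_max_add_one_sq a x
  have h₂ : max a x + 1 ≤ 2 ^ e := by have := max_lt ha hx; omega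
  have h₃ := Nat.pow_le_pow_left h₂ 2
  have h₄ : 2 ^ (2 * e + 1) = 2 * (2 ^ e) ^ 2 := by ring
  have h₅ : 0 < (2 ^ e) ^ 2 := by positivity
  omega

theorem palette_lt {κ L m l : ℕ} (hL : 0 < L) (hm : m ≤ 2 ^ (2 * L + 1)) (hl : l ≤ L.size) :
    palette (2048 * m) κ l < 2 ^ ((41 + 2 * κ) * L) := by
  have h₁ : 2 ^ l ≤ 2 * L := by
    have h₀ : 0 < L.size := Nat.size_pos.2 hL
    have h₂ : 2 ^ (L.size - 1) ≤ L := Nat.lt_size.1 (by omega)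
    calc 2 ^ l ≤ 2 ^ (L.size - 1 + 1) := Nat.pow_le_pow_right (by norm_num) (by omega)
      _ ≤ 2 * L := by rw [pow_succ]; omega
  have h₂ : L ≤ 2 ^ L := Nat.lt_two_pow_self.le
  have h₃ : 4 ^ l ≤ 2 ^ (2 * L + 2) := by
    calc 4 ^ l = 2 ^ l * 2 ^ l := by rw [← mul_pow]; norm_num
      _ ≤ (2 * 2 ^ L) * (2 * 2 ^ L) := by gcongr <;> omega
      _ = 2 ^ (2 * L + 2) := by ring
  calc palette (2048 * m) κ l ≤ 256 * (2048 * 2 ^ (2 * L + 1)) ^ 2 * 2 ^ (2 * L + 2) *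
        2 ^ (κ * (2 * L)) := by
        rw [palette]
        gcongr
        norm_num
    _ = 2 ^ (34 + 6 * L + 2 * κ * L) := by
      rw [show 256 = 2 ^ 8 by norm_num, show 2048 = 2 ^ 11 by norm_num]
      simp only [← pow_add, ← pow_mul]
      congr 1
      ring
    _ < _ := Nat.pow_lt_pow_right (by norm_num) (by nlinarith)

theorem stageRounds_le (κ L m : ℕ) (hm : 0 < m) :
    stageRounds κ L m ≤ L * (7 + 12 * 256 * 2048 ^ 2 * 2 ^ κ) * m ^ 2 := by
  have h₁ : L.size ≤ L := Nat.size_le.2 Nat.lt_two_pow_self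
  have h₂ : 1 ≤ m ^ 2 := Nat.one_le_pow _ _ hm
  have h₃ : stageRounds κ L m ≤ 7 * L + 12 * L * palette (2048 * m) κ 0 := by
    simp only [stageRounds, sweepRounds]
    rw [show 12 * L * palette (2048 * m) κ 0 =
      6 * L * palette (2048 * m) κ 0 + 6 * L * palette (2048 * m) κ 0 by ring]
    omega
  have h₄ : palette (2048 * m) κ 0 = 256 * 2048 ^ 2 * 2 ^ κ * m ^ 2 := by
    simp only [palette, pow_zero, mul_one]
    ring
  rw [h₄] at h₃
  calc _ ≤ _ := h₃
    _ ≤ 7 * L * m ^ 2 + 12 * L * (256 * 2048 ^ 2 * 2 ^ κ * m ^ 2) := by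
      exact Nat.add_le_add_right (Nat.le_mul_of_pos_right _ h₂) _
    _ = _ := by ring

theorem logBits_le {n : ℕ} (hn : 2 ≤ n) : (logBits n : ℝ) ≤ 3 * Real.log n := by
  have h₁ : (Nat.log 2 n : ℝ) * Real.log 2 ≤ Real.log n := by
    rw [← Real.log_pow]
    exact Real.log_le_log (by positivity) (by exact_mod_cast Nat.pow_log_le_self 2 (by omega))
  have h₂ : (1 : ℝ) ≤ Nat.log 2 n := by
    exact_mod_cast Nat.log_pos (by norm_num) hn
  have h₃ := Real.log_two_gt_d9
  rw [logBits]
  push_cast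
  nlinarith

/-! ### The main theorem -/

theorem optWeight_le {V : Type*} [Fintype V] (G : SimpleGraph V) (w : V → ℝ≥0) :
    optWeight G w ≤ ∑ v, w v :=
  Finset.sup_le fun Y _ => Finset.sum_le_sum_of_subset (Finset.subset_univ Y)

theorem Sparse.isIndepSet {V : Type*} [DecidableEq V] {G : SimpleGraph V} {Γ : V → Finset V}
    (hΓ : ∀ v u, u ∈ Γ v ↔ G.Adj v u) {X : Finset V} (h : Sparse Γ X 0) :
    G.IsIndepSet (X : Set V) := by
  intro v hv u hu _ hadj
  have h₁ := h X subset_rfl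
  simp only [mul_zero, zero_mul, nonpos_iff_eq_zero, Finset.sum_eq_zero_iff,
    Finset.card_eq_zero] at h₁
  have h₂ : u ∈ Γ v ∩ X := Finset.mem_inter.2 ⟨(hΓ v u).2 hadj, hu⟩
  rw [h₁ v hv] at h₂
  simp at h₂

/-- The process run by a node. -/
noncomputable def mwisProc (dec : List Bool → ℝ≥0) (κ K n a i : ℕ) (x : ℝ≥0) (_d : ℕ) : Proc Bool :=
  if n ≤ 1 then Proc.pure true else stages dec κ (logBits n) (stageFactor K a) i x K a true

theorem mainTheorem2 (τ : ℝ) (hτ : 0 < τ) (c : ℕ) :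
    ∃ (B : ℕ) (C : ℝ), ∀ dec : List Bool → ℝ≥0, ∃ A : DistAlgorithm,
      ∀ (V : Type) [Fintype V] [DecidableEq V] (N : Network V), N.HasLogSizeInput c dec →
        A.MessagesBounded N (B * logBits (Fintype.card V)) ∧
        ∃ R : ℕ,
          (R : ℝ) ≤ C * (arboricity N.graph : ℝ) ^ τ * Real.log (Fintype.card V) ∧
          A.HaltsBy N R ∧
          IsMWISApprox N.graph N.weight (8 ^ ⌈1 / τ⌉₊ * (arboricity N.graph : ℝ≥0))
            (A.outputSet N R) := by
  set k := ⌈1 / τ⌉₊ with hk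
  have hk0 : 0 < k := Nat.ceil_pos.2 (by positivity)
  set Q : ℕ := 7 + 12 * 256 * 2048 ^ 2 * 2 ^ c with hQ
  refine ⟨83 + 4 * c, 3 * (2 * k) * Q * 4, fun dec =>
    ⟨Proc.toAlgorithm (mwisProc dec c (2 * k)), fun V _ _ N hN => ?_⟩⟩
  set n := Fintype.card V with hn
  set L := logBits n with hL
  have hL0 : 0 < L := Nat.succ_pos _
  set a := arboricity N.graph with ha
  have ha0 : 0 < a := (arboricity_mem N.graph).1
  rcases Nat.lt_or_ge 1 n with h1 | h1
  swap
  -- Since `log n = 0` here, the node must decide without any communication.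
  · have hV : Subsingleton V := Fintype.card_le_one_iff_subsingleton.1 h1
    obtain ⟨hmsg, hhalt, hout⟩ := Proc.toAlgorithm_spec (b := (83 + 4 * c) * L) (t := 0)
      (mwisProc dec c (2 * k)) N (out := fun _ => true) (by
        simp only [mwisProc, ← hn, if_pos h1]
        exact Proc.Runs.pure _)
    refine ⟨hmsg, 0, ?_, hhalt, ?_, ?_⟩
    · have := Real.log_natCast_nonneg n
      push_cast
      positivity
    · intro v _ u _ hvu
      exact absurd (Subsingleton.elim v u) hvu
    · rw [hout]
      refine (optWeight_le _ _).trans ?_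
      simp only [setWeight, Finset.filter_true]
      refine le_mul_of_one_le_left zero_le ?_
      have h₁ : 1 ≤ 8 ^ k * a := Nat.succ_le_of_lt (by positivity)
      exact_mod_cast h₁
  · set m := stageFactor (2 * k) a with hm
    have hm0 : 0 < m := Nat.succ_pos _
    have hnL : n < 2 ^ L := Nat.lt_pow_succ_log_self (by norm_num) n
    have hmL : m ≤ 2 ^ (2 * L + 1) := by
      have h₁ : m ≤ a + 1 := stageFactor_le (by omega) ha0
      have h₂ : a ≤ n ^ 2 + 1 := arboricity_le_sq N.graph
      have h₃ : 2 ^ (2 * L + 1) = 2 * (2 ^ L) ^ 2 := by ring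
      have h₄ : (n + 1) ^ 2 ≤ (2 ^ L) ^ 2 := Nat.pow_le_pow_left hnL 2
      nlinarith
    have hE : (41 + 2 * c) * L * 2 + 1 ≤ (83 + 4 * c) * L := by nlinarith
    have hpair : ∀ x y, x < 2 ^ ((41 + 2 * c) * L) → y < 2 ^ ((41 + 2 * c) * L) →
        Nat.pair x y + 1 < 2 ^ ((83 + 4 * c) * L) := fun x y hx hy =>
      (pair_add_one_lt hx hy).trans_le (Nat.pow_le_pow_right (by norm_num) (by linarith))
    have hLlt : L < 2 ^ L := Nat.lt_two_pow_self
    have hadj : ∀ v u, u ∈ (N.nbrs v).toFinset ↔ N.graph.Adj v u := fun v u => by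
      rw [List.mem_toFinset, N.mem_nbrs]
    obtain ⟨J, -, run, hsp, hle⟩ := stages_spec (nbrs := N.nbrs) (b := (83 + 4 * c) * L) (κ := c)
      (L := L) (m := m) (dec := dec) (i := N.ident) (w := N.weight) N.nbrs_nodup
      (fun v u => by rw [N.mem_nbrs, N.mem_nbrs, SimpleGraph.adj_comm])
      (fun v => by rw [N.mem_nbrs]; exact N.graph.irrefl) N.ident_injective
      (fun v => Nat.size_le.1 (hN.1 v)) hN.2 hm0
      (fun x hx l hl y hy => hpair x y (by
        calc x < 2 ^ 3 * 2 ^ L := by omega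
          _ = 2 ^ (3 + L) := by rw [pow_add]
          _ ≤ _ := Nat.pow_le_pow_right (by norm_num) (by nlinarith))
        (hy.trans (palette_lt hL0 hmL hl)))
      (fun x hx j hj => hpair x j
        (hx.trans_le (Nat.pow_le_pow_right (by norm_num) (by nlinarith))) (by
        calc j < 2 ^ 7 := by omega
          _ ≤ _ := Nat.pow_le_pow_right (by norm_num) (by nlinarith)))
      (2 * k) Finset.univ a (by rwa [Finset.card_univ]) (sparse_arboricity hadj)
    have hzero : (nextSparsity m)^[2 * k] a = 0 := by
      refine Nat.eq_zero_of_le_zero ((nextSparsity_iterate_le hm0 _ _).trans ?_)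
      rw [Nat.div_eq_of_lt (lt_stageFactor_pow (by omega) a)]
    rw [hzero] at hsp
    obtain ⟨hmsg, hhalt, hout⟩ := Proc.toAlgorithm_spec (b := (83 + 4 * c) * L)
      (mwisProc dec c (2 * k)) N (out := fun v => decide (v ∈ J)) (by
        simp only [mwisProc, ← hn, if_neg (not_le.2 h1)]
        simpa using run)
    have hJ : (Finset.univ.filter fun v => decide (v ∈ J) = true) = J := by
      ext v; simp
    rw [hJ] at hout
    refine ⟨hmsg, _, ?_, hhalt, ?_, ?_⟩
    · have h₁ : ((2 * k * stageRounds c L m : ℕ) : ℝ) ≤ 2 * k * (L * Q * (m : ℝ) ^ 2) := by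
        exact_mod_cast Nat.mul_le_mul_left (2 * k) (stageRounds_le c L m hm0)
      have h₂ := stageFactor_sq_le hτ ha0
      have h₃ := logBits_le h1
      calc _ ≤ _ := h₁
        _ ≤ 2 * k * (3 * Real.log n * Q * (4 * (a : ℝ) ^ τ)) := by gcongr
        _ = _ := by ring
    · rw [hout]
      exact hsp.isIndepSet hadj
    · rw [hout]
      refine (optWeight_le _ _).trans (hle.trans ?_)
      rw [setWeight]
      gcongr
      refine (stagesLoss_le hm0 _ _ hzero).trans ?_
      rw [if_neg ha0.ne', ← mul_assoc]
      gcongr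
      -- One of the `k` factors `(5 / 2) ^ 2` absorbs the constant: `25 / 4 * (32 / 25) = 8`; the
      -- others satisfy `25 / 4 ≤ 8`.
      obtain ⟨j, hj⟩ : ∃ j, k = j + 1 := ⟨k - 1, by omega⟩
      rw [hj, pow_mul, pow_succ, pow_succ, mul_assoc]
      refine mul_le_mul' (pow_le_pow_left₀ zero_le ?_ j) ?_ <;>
      · rw [← NNReal.coe_le_coe]
        push_cast
        norm_num
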